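/- Let $A\in\mathbb R^{n\times n}$, $B\in\mathbb R^{n\times m}$, $C\in\mathbb R^{p\times n}$, $D\in\mathbb R^{p\times m}$, $X_0\in\mathbb R^{n\times q}$, and let the system $$\dot x(t)=Ax(t)+Bu(t),\quad x(0)=X_0z_0,\qquad y(t)=Cx(t)+Du(t),\qquad t\ge 0,$$ be asymptotically stable, i.e. all eigenvalues of $A$ have negative real part. For an input matrix $\mathcal B$ with $n$ rows and $1\le r\le n$, we write $[V_r,W_r,\sigma_1,\dots,\sigma_n]=\operatorname{BT}(A,\mathcal B,C,r)$ for balanced truncation: let $P,Q$ be the Gramians, i.e. $AP+PA^{\mathsf T}+\mathcal B\mathcal B^{\mathsf T}=0$ and $A^{\mathsf T}Q+QA+C^{\mathsf T}C=0$, factorized as $P=RR^{\mathsf T}$, $Q=LL^{\mathsf T}$ with $R,L\in\mathbb R^{n\times n}$, and let $L^{\mathsf T}R=U\operatorname{diag}(\sigma_1,\dots,\sigma_n)Z^{\mathsf T}$ be a singular value decomposition with $\sigma_1\ge\dots\ge\sigma_n\ge0$ (the Hankel singular values); with $U_r,Z_r$ the first $r$ columns of $U,Z$ and $\Sigma_r=\operatorname{diag}(\sigma_1,\dots,\sigma_r)$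 nonsingular, put $V_r=RZ_r\Sigma_r^{-1/2}$ and $W_r=LU_r\Sigma_r^{-1/2}$. Put $\sigma_{n+1}:=0$. Let $\alpha>0$, $k,\ell\ge1$, and $$[V_k,W_k,\sigma_1,\dots,\sigma_n]=\operatorname{BT}(A,B,C,k),\qquad [\hat V_\ell,\hat W_\ell,\theta_1,\dots,\theta_n]=\operatorname{BT}\Big(A,\tfrac1{\sqrt{2\alpha}}(A+\alpha I_n)X_0,C,\ell\Big),$$ for any choice of the factors and of the singular value decompositions. Put $A_k=W_k^{\mathsf T}AV_k$, $B_k=W_k^{\mathsf T}B$, $C_k=CV_k$, $\hat A_\ell=\hat W_\ell^{\mathsf T}A\hat V_\ell$, $\hat C_\ell=C\hat V_\ell$. Suppose that $\sigma_k>\sigma_{k+1}$, $\theta_\ell>\theta_{\ell+1}$ and that $-\alpha$ is not an eigenvalue of $\hat A_\ell$, and put $X_{0,\ell}=(\hat A_\ell+\alpha I_\ell)^{-1}\hat W_\ell^{\mathsf T}(A+\alpha I_n)X_0$ and $\hat F_\ell=CX_0-\hat C_\ell X_{0,\ell}$. Consider the reduced-order model $$\begin{bmatrix}\dot x_k\\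 \dot{\hat x}_\ell\end{bmatrix}=\begin{bmatrix}A_k&0\\0&\hat A_\ell\end{bmatrix}\begin{bmatrix}x_k\\ \hat x_\ell\end{bmatrix}+\begin{bmatrix}B_k\\0\end{bmatrix}u,\quad \begin{bmatrix}x_k(0)\\ \hat x_\ell(0)\end{bmatrix}=\begin{bmatrix}0\\X_{0,\ell}z_0\end{bmatrix},\qquad y_r(t)=\begin{bmatrix}C_k&\hat C_\ell\end{bmatrix}\begin{bmatrix}x_k(t)\\ \hat x_\ell(t)\end{bmatrix}+Du(t)+\hat F_\ell z_0e^{-\alpha t}.$$ Then the reduced-order model is asymptotically stable, i.e. all eigenvalues of $\operatorname{diag}(A_k,\hat A_\ell)$ have negative real part. For all $z_0\in\mathbb R^q$ and all inputs $u$ (solutions being understood in the integrated sense) we have $y_r(0)=y(0)$, and if $u\in\mathbb L_2([0,\infty),\mathbb R^m)$, then $y-y_r\in\mathbb L_2([0,\infty),\mathbb R^p)$ and $$\|y-y_r\|_{\mathbb L_2}\le 2(\sigma_{k+1}+\dots+\sigma_n)\|u\|_{\mathbb L_2}+2(\theta_{\ell+1}+\dots+\theta_n)\|z_0\|_2 .$$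 -/

import Mathlib

open MeasureTheory Matrix

noncomputable section

namespace ShiftBT

/-- Asymptotic stability of `x' = A x`: all (complex) eigenvalues of the real matrix `A` lie in the
open left half-plane. -/
def IsAsymptoticallyStable {ι : Type*} [Fintype ι] [DecidableEq ι] (A : Matrix ι ι ℝ) : Prop :=
  ∀ μ ∈ spectrum ℂ (A.map (fun a : ℝ => (a : ℂ))), μ.re < 0

/-- `x` is the (Carathéodory) solution on `[0, ∞)` of `x' = A x + B u`, `x(0) = x₀`, in integrated
form. Only the values of `u` and `x` on `[0, ∞)` matter. -/
structure IsTrajectory {ι κ : Type*} [Fintype ι] [Fintype κ]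
    (A : Matrix ι ι ℝ) (B : Matrix ι κ ℝ) (u : ℝ → κ → ℝ) (x₀ : ι → ℝ) (x : ℝ → ι → ℝ) : Prop where
  continuousOn : ContinuousOn x (Set.Ici 0)
  intervalIntegrable : ∀ t, 0 ≤ t →
    IntervalIntegrable (fun s => A *ᵥ x s + B *ᵥ u s) volume 0 t
  eq_integral : ∀ t, 0 ≤ t → x t = x₀ + ∫ s in (0 : ℝ)..t, (A *ᵥ x s + B *ᵥ u s)

/-- `g ∈ L₂([0, ∞), ℝ^κ)`, where `ℝ^κ` carries the Euclidean norm. -/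
def MemL2 {κ : Type*} [Fintype κ] (g : ℝ → κ → ℝ) : Prop :=
  MemLp (fun t => WithLp.toLp 2 (g t)) 2 (volume.restrict (Set.Ici (0 : ℝ)))

/-- The norm `(∫₀^∞ g(t)ᵀ g(t) dt)^{1/2}` of `L₂([0, ∞), ℝ^κ)`. -/
def normL2 {κ : Type*} [Fintype κ] (g : ℝ → κ → ℝ) : ℝ :=
  Real.sqrt (∫ t in Set.Ici (0 : ℝ), g t ⬝ᵥ g t)

/-- `[V, W, σ₁, …, σₙ] = BT(A, B, C, r)`: balanced truncation by the square-root method.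
`P`, `Q` are the controllability and the observability Gramian, `P = R Rᵀ`, `Q = L Lᵀ`, and
`Lᵀ R = U diag(σ₁, …, σₙ) Zᵀ` is a singular value decomposition, so the `σᵢ` are the Hankel
singular values (the `σᵢ²` are the eigenvalues of `P Q`). The projection matrices are
`V = R Z_r Σ_r^{-1/2}` and `W = L U_r Σ_r^{-1/2}`, with the leading `r` columns `Z_r`, `U_r` of `Z`,
`U` and `Σ_r = diag(σ₁, …, σ_r)`. The factors and the decomposition are not unique; every choice is
admitted (low-rank factors with fewer than `n` columns are filled up with zero columns). The sequence
is indexed from `1`, with `σᵢ = 0` for `i > n` by convention. -/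
def IsBalancedTruncation {n m p : ℕ} (A : Matrix (Fin n) (Fin n) ℝ) (B : Matrix (Fin n) (Fin m) ℝ)
    (C : Matrix (Fin p) (Fin n) ℝ) (r : ℕ) (V W : Matrix (Fin n) (Fin r) ℝ) (σ : ℕ → ℝ) : Prop :=
  ∃ hr : r ≤ n, ∃ P Q R L U Z : Matrix (Fin n) (Fin n) ℝ,
    A * P + P * Aᵀ + B * Bᵀ = 0 ∧
    Aᵀ * Q + Q * A + Cᵀ * C = 0 ∧
    P = R * Rᵀ ∧ Q = L * Lᵀ ∧
    U ∈ Matrix.orthogonalGroup (Fin n) ℝ ∧ Z ∈ Matrix.orthogonalGroup (Fin n) ℝ ∧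
    Lᵀ * R = U * Matrix.diagonal (fun i : Fin n => σ (i + 1)) * Zᵀ ∧
    (∀ i, 0 ≤ σ i) ∧ (∀ i j, 1 ≤ i → i ≤ j → σ j ≤ σ i) ∧ (∀ i, n < i → σ i = 0) ∧
    V = R * Z.submatrix id (Fin.castLE hr) *
      Matrix.diagonal (fun i : Fin r => (Real.sqrt (σ (i + 1)))⁻¹) ∧
    W = L * U.submatrix id (Fin.castLE hr) *
      Matrix.diagonal (fun i : Fin r => (Real.sqrt (σ (i + 1)))⁻¹)

/-- The shifted input matrix `(A + α I) X₀ / √(2α)`. -/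
def shiftedInput {n q : ℕ} (A : Matrix (Fin n) (Fin n) ℝ) (X₀ : Matrix (Fin n) (Fin q) ℝ) (α : ℝ) :
    Matrix (Fin n) (Fin q) ℝ :=
  (1 / Real.sqrt (2 * α)) • ((A + α • (1 : Matrix (Fin n) (Fin n) ℝ)) * X₀)

/-- The projected state matrix `Wᵀ A V`. -/
def redA {n r : ℕ} (A : Matrix (Fin n) (Fin n) ℝ) (V W : Matrix (Fin n) (Fin r) ℝ) :
    Matrix (Fin r) (Fin r) ℝ :=
  Wᵀ * A * V

/-- The reduced initial value matrix `(Â + α I)⁻¹ Ŵᵀ (A + α I) X₀` with `Â = Ŵᵀ A V̂`. -/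
def redX₀ {n q l : ℕ} (A : Matrix (Fin n) (Fin n) ℝ) (X₀ : Matrix (Fin n) (Fin q) ℝ) (α : ℝ)
    (V' W' : Matrix (Fin n) (Fin l) ℝ) : Matrix (Fin l) (Fin q) ℝ :=
  (redA A V' W' + α • (1 : Matrix (Fin l) (Fin l) ℝ))⁻¹ * W'ᵀ *
    (A + α • (1 : Matrix (Fin n) (Fin n) ℝ)) * X₀

/-- The matrix `F̂ = C X₀ - Ĉ X₀,ₗ` with `Ĉ = C V̂`. -/
def redF {n p q l : ℕ} (A : Matrix (Fin n) (Fin n) ℝ) (C : Matrix (Fin p) (Fin n) ℝ)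
    (X₀ : Matrix (Fin n) (Fin q) ℝ) (α : ℝ) (V' W' : Matrix (Fin n) (Fin l) ℝ) :
    Matrix (Fin p) (Fin q) ℝ :=
  C * X₀ - C * V' * redX₀ A X₀ α V' W'

/-- The state matrix `diag(A_k, Âₗ)` of the separate-projection model. -/
def romA {n k l : ℕ} (A : Matrix (Fin n) (Fin n) ℝ) (V W : Matrix (Fin n) (Fin k) ℝ)
    (V' W' : Matrix (Fin n) (Fin l) ℝ) : Matrix (Fin k ⊕ Fin l) (Fin k ⊕ Fin l) ℝ :=
  Matrix.fromBlocks (redA A V W) 0 0 (redA A V' W')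

/-- The input matrix `[Wᵀ B; 0]` of the separate-projection model. -/
def romB {n m k : ℕ} (l : ℕ) (B : Matrix (Fin n) (Fin m) ℝ) (W : Matrix (Fin n) (Fin k) ℝ) :
    Matrix (Fin k ⊕ Fin l) (Fin m) ℝ :=
  Matrix.fromRows (Wᵀ * B) 0

/-- The output matrix `[C V, C V̂]` of the separate-projection model. -/
def romC {n p k l : ℕ} (C : Matrix (Fin p) (Fin n) ℝ) (V : Matrix (Fin n) (Fin k) ℝ)
    (V' : Matrix (Fin n) (Fin l) ℝ) : Matrix (Fin p) (Fin k ⊕ Fin l) ℝ :=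
  Matrix.fromCols (C * V) (C * V')

/-- The initial state `(0, X₀,ₗ z₀)` of the separate-projection model. -/
def romInit {n q l : ℕ} (k : ℕ) (A : Matrix (Fin n) (Fin n) ℝ) (X₀ : Matrix (Fin n) (Fin q) ℝ)
    (α : ℝ) (V' W' : Matrix (Fin n) (Fin l) ℝ) (z₀ : Fin q → ℝ) : Fin k ⊕ Fin l → ℝ :=
  Sum.elim 0 (redX₀ A X₀ α V' W' *ᵥ z₀)

end ShiftBT

end

namespace ShiftBT

/-! The initial value is turned into an input. If `x` solves the full system and `ζ` is its
zero-state response to `u`, then `x - ζ - e^{-αt} X₀ z₀` is the zero-state response to the decaying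
input `√(2α) e^{-αt} z₀` fed through `(A + α I) X₀ / √(2α)` (`IsTrajectory.sub_sub_exp`). The
reduced initial value is chosen so that the same shift applies to the second reduced block with the
projected input matrix. In `y - y_r` the two exponential terms cancel against `F̂`, leaving the sum
of two ordinary balanced truncation errors, one driven by `u` and one by an input of norm at most
`‖z₀‖` (`eLpNorm_exp_input_le`).

The error bound for balanced truncation is proved in the time domain on `[0, T]`, removing one state
at a time. With `z` and `w` the difference and the sum of the state before truncation and the
embedded reduced state, `S` the balanced Gramian and `s` its last diagonal entry, the storage
function `zᵀ S z + s² wᵀ S⁻¹ w` gives gain `2 s` (`truncation_dissipation`). Vanishing singular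
values, where `S` is not invertible, are handled separately: the defect of the projection is then
invisible to the observability Gramian, and the output is reproduced exactly. No stability of
intermediate models is needed on a finite horizon, and the bounds are uniform in `T`.

Stability of the truncation follows from the gap. An unstable eigenvalue of the reduced matrix has
an eigenvector `w` that is also an eigenvector of `S²`. The Lyapunov equations and the gap force `V
w` to be an eigenvector of `A` for the same eigenvalue (`exists_eigenvector_of_truncation`), which
contradicts stability of `A`. -/

/-! ### Calculus of primitives of integrable functions. -/

/-- Product rule for indefinite integrals. -/
theorem intervalIntegral_mul_intervalIntegral {f g : ℝ → ℝ} {a b : ℝ}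
    (hf : IntervalIntegrable f volume a b) (hg : IntervalIntegrable g volume a b) :
    (∫ t in a..b, f t) * (∫ t in a..b, g t) =
      ∫ t in a..b, (f t * (∫ s in a..t, g s) + (∫ s in a..t, f s) * g t) := by
  have h := AbsolutelyContinuousOnInterval.integral_deriv_mul_eq_sub
    (hf.absolutelyContinuousOnInterval_intervalIntegral Set.left_mem_uIcc)
    (hg.absolutelyContinuousOnInterval_intervalIntegral Set.left_mem_uIcc)
  simp only [intervalIntegral.integral_same, mul_zero, sub_zero] at h
  rw [← h]
  -- The integrands are merely integrable, so the primitives have the expected derivatives only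
  -- almost everywhere.
  apply intervalIntegral.integral_congr_ae
  filter_upwards [hf.ae_hasDerivAt_integral, hg.ae_hasDerivAt_integral] with x h₁ h₂ hx
  have hx' := Set.uIoc_subset_uIcc hx
  rw [(h₁ hx' a Set.left_mem_uIcc).deriv, (h₂ hx' a Set.left_mem_uIcc).deriv]

/-- `x` is the primitive of `f` on `[0, ∞)` that vanishes at `0`. -/
structure IsPrimitive {ι : Type*} [Fintype ι] (f x : ℝ → ι → ℝ) : Prop where
  intervalIntegrable : ∀ t, 0 ≤ t → IntervalIntegrable f volume 0 t
  eq_integral : ∀ t, 0 ≤ t → x t = ∫ s in (0 : ℝ)..t, f s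

section

variable {ι κ : Type*} [Fintype ι] [Fintype κ]

theorem intervalIntegrable_mulVec (M : Matrix κ ι ℝ) {f : ℝ → ι → ℝ} {a b : ℝ}
    (hf : IntervalIntegrable f volume a b) :
    IntervalIntegrable (fun t => M *ᵥ f t) volume a b := by
  classical
  exact ⟨(Matrix.toLin' M).toContinuousLinearMap.integrable_comp hf.1,
    (Matrix.toLin' M).toContinuousLinearMap.integrable_comp hf.2⟩

theorem intervalIntegral_mulVec (M : Matrix κ ι ℝ) {f : ℝ → ι → ℝ} {a b : ℝ}
    (hf : IntervalIntegrable f volume a b) :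
    ∫ t in a..b, M *ᵥ f t = M *ᵥ ∫ t in a..b, f t := by
  classical
  simpa using (Matrix.toLin' M).toContinuousLinearMap.intervalIntegral_comp_comm hf

theorem intervalIntegrable_apply {f : ℝ → ι → ℝ} {a b : ℝ}
    (hf : IntervalIntegrable f volume a b) (i : ι) :
    IntervalIntegrable (fun t => f t i) volume a b :=
  ⟨(ContinuousLinearMap.proj (R := ℝ) (φ := fun _ : ι => ℝ) i).integrable_comp hf.1,
    (ContinuousLinearMap.proj (R := ℝ) (φ := fun _ : ι => ℝ) i).integrable_comp hf.2⟩

theorem intervalIntegral_apply {f : ℝ → ι → ℝ} {a b : ℝ}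
    (hf : IntervalIntegrable f volume a b) (i : ι) :
    (∫ t in a..b, f t) i = ∫ t in a..b, f t i :=
  ((ContinuousLinearMap.proj (R := ℝ) (φ := fun _ : ι => ℝ) i).intervalIntegral_comp_comm hf).symm

theorem IsPrimitive.continuousOn {f x : ℝ → ι → ℝ} (h : IsPrimitive f x) {T : ℝ} (hT : 0 ≤ T) :
    ContinuousOn x (Set.uIcc 0 T) := by
  refine (intervalIntegral.continuousOn_primitive_interval (h.intervalIntegrable T hT |>.1.congr_set_ae
    ?_ )).congr fun t ht => h.eq_integral t ?_
  · rw [Set.uIcc_of_le hT]; exact Ioc_ae_eq_Icc.symm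
  · rw [Set.uIcc_of_le hT] at ht; exact ht.1

theorem IsPrimitive.add {f g x y : ℝ → ι → ℝ} (hx : IsPrimitive f x) (hy : IsPrimitive g y) :
    IsPrimitive (fun t => f t + g t) (fun t => x t + y t) where
  intervalIntegrable t ht := (hx.intervalIntegrable t ht).add (hy.intervalIntegrable t ht)
  eq_integral t ht := by
    rw [intervalIntegral.integral_add (hx.intervalIntegrable t ht) (hy.intervalIntegrable t ht),
      hx.eq_integral t ht, hy.eq_integral t ht]

theorem IsPrimitive.sub {f g x y : ℝ → ι → ℝ} (hx : IsPrimitive f x) (hy : IsPrimitive g y) :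
    IsPrimitive (fun t => f t - g t) (fun t => x t - y t) where
  intervalIntegrable t ht := (hx.intervalIntegrable t ht).sub (hy.intervalIntegrable t ht)
  eq_integral t ht := by
    rw [intervalIntegral.integral_sub (hx.intervalIntegrable t ht) (hy.intervalIntegrable t ht),
      hx.eq_integral t ht, hy.eq_integral t ht]

theorem IsPrimitive.mulVec (M : Matrix κ ι ℝ) {f x : ℝ → ι → ℝ} (hx : IsPrimitive f x) :
    IsPrimitive (fun t => M *ᵥ f t) (fun t => M *ᵥ x t) where
  intervalIntegrable t ht := intervalIntegrable_mulVec M (hx.intervalIntegrable t ht)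
  eq_integral t ht := by
    rw [intervalIntegral_mulVec M (hx.intervalIntegrable t ht), hx.eq_integral t ht]

theorem IsTrajectory.isPrimitive {A : Matrix ι ι ℝ} {B : Matrix ι κ ℝ} {u : ℝ → κ → ℝ}
    {x : ℝ → ι → ℝ} (h : IsTrajectory A B u 0 x) :
    IsPrimitive (fun t => A *ᵥ x t + B *ᵥ u t) x where
  intervalIntegrable := h.intervalIntegrable
  eq_integral t ht := by rw [h.eq_integral t ht, zero_add]

theorem intervalIntegrable_dotProduct {f g : ℝ → ι → ℝ} {a b : ℝ}
    (hf : IntervalIntegrable f volume a b) (hg : ContinuousOn g (Set.uIcc a b)) :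
    IntervalIntegrable (fun t => f t ⬝ᵥ g t) volume a b := by
  unfold dotProduct
  have h := IntervalIntegrable.sum Finset.univ (f := fun i t => f t i * g t i) (μ := volume)
    (a := a) (b := b) fun i _ => (intervalIntegrable_apply hf i).mul_continuousOn
      ((continuous_apply i).comp_continuousOn hg)
  simpa only [Finset.sum_fn] using h

/-- Product rule for the inner product of two primitives. -/
theorem IsPrimitive.dotProduct {f g x y : ℝ → ι → ℝ} (hx : IsPrimitive f x) (hy : IsPrimitive g y)
    {T : ℝ} (hT : 0 ≤ T) :
    x T ⬝ᵥ y T = ∫ t in (0 : ℝ)..T, (f t ⬝ᵥ y t + x t ⬝ᵥ g t) := by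
  have hf := hx.intervalIntegrable T hT
  have hg := hy.intervalIntegrable T hT
  have e₁ : ∀ i, x T i * y T i = ∫ t in (0 : ℝ)..T, (f t i * y t i + x t i * g t i) := by
    intro i
    rw [hx.eq_integral T hT, hy.eq_integral T hT, intervalIntegral_apply hf,
      intervalIntegral_apply hg, intervalIntegral_mul_intervalIntegral
        (intervalIntegrable_apply hf i) (intervalIntegrable_apply hg i)]
    apply intervalIntegral.integral_congr
    intro t ht
    rw [Set.uIcc_of_le hT] at ht
    simp only
    rw [hx.eq_integral t ht.1, hy.eq_integral t ht.1,
      intervalIntegral_apply (hx.intervalIntegrable t ht.1),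
      intervalIntegral_apply (hy.intervalIntegrable t ht.1)]
  simp only [_root_.dotProduct, ← Finset.sum_add_distrib]
  rw [intervalIntegral.integral_finsetSum]
  · exact Finset.sum_congr rfl fun i _ => e₁ i
  · intro i _
    exact ((intervalIntegrable_apply hf i).mul_continuousOn
        ((continuous_apply i).comp_continuousOn (hy.continuousOn hT))).add
      ((intervalIntegrable_apply hg i).continuousOn_mul
        ((continuous_apply i).comp_continuousOn (hx.continuousOn hT)))

/-- Rate of change of a quadratic storage function along a primitive. -/
theorem IsPrimitive.quadratic (M : Matrix ι ι ℝ) (hM : Mᵀ = M) {f x : ℝ → ι → ℝ}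
    (hx : IsPrimitive f x) {T : ℝ} (hT : 0 ≤ T) :
    IntervalIntegrable (fun t => 2 * (f t ⬝ᵥ M *ᵥ x t)) volume 0 T ∧
    x T ⬝ᵥ M *ᵥ x T = ∫ t in (0 : ℝ)..T, 2 * (f t ⬝ᵥ M *ᵥ x t) := by
  constructor
  · exact (intervalIntegrable_dotProduct (hx.intervalIntegrable T hT)
      ((hx.mulVec M).continuousOn hT)).const_mul 2
  · rw [hx.dotProduct (hx.mulVec M) hT]
    congr 1
    ext t
    have : x t ⬝ᵥ M *ᵥ f t = f t ⬝ᵥ M *ᵥ x t := by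
      rw [dotProduct_mulVec, ← mulVec_transpose, hM, dotProduct_comm]
    rw [this]; ring

end

/-! ### Existence of trajectories. -/

/-- Existence of solutions of `x' = L x + f`, `x(0) = 0` in integrated form. -/
theorem exists_eq_integral_clm_add {E : Type*} [NormedAddCommGroup E] [NormedSpace ℝ E]
    [CompleteSpace E] (L : E →L[ℝ] E) {f : ℝ → E}
    (hf : ∀ a b, IntervalIntegrable f volume a b) :
    ∃ x : ℝ → E, Continuous x ∧ ∀ t, x t = ∫ s in (0 : ℝ)..t, (L (x s) + f s) := by
  set U : ℝ → E := fun t => ∫ s in (0 : ℝ)..t, f s with hU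
  have hUc : Continuous U := intervalIntegral.continuous_primitive hf 0
  set S : ℝ → E →L[ℝ] E := fun t => NormedSpace.exp (t • L) with hS
  have hSd : ∀ t, HasDerivAt S (L * S t) t := fun t => hasDerivAt_exp_smul_const' L t
  have hSc : Continuous S := continuous_iff_continuousAt.2 fun t => (hSd t).continuousAt
  have hSS : ∀ t, S t * S (-t) = 1 := by
    intro t
    have hc : Commute (t • L) ((-t) • L) := ((Commute.refl L).smul_left t).smul_right (-t)
    let +nondep : NormedAlgebra ℚ (E →L[ℝ] E) := .restrictScalars ℚ ℝ (E →L[ℝ] E)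
    simp only [hS]
    rw [← NormedSpace.exp_add_of_commute hc, ← add_smul, add_neg_cancel, zero_smul,
      NormedSpace.exp_zero]
  have hg : Continuous fun s => S (-s) (L (U s)) :=
    (hSc.comp continuous_neg).clm_apply (L.continuous.comp hUc)
  -- Put `x = ξ + U` with `U` the primitive of `f`: then `ξ' = L ξ + L U` has a continuous forcing
  -- term, and variation of constants gives a classically differentiable `ξ`.
  set ξ : ℝ → E := fun t => S t (∫ s in (0 : ℝ)..t, S (-s) (L (U s))) with hξ
  have hξd : ∀ t, HasDerivAt ξ (L (ξ t) + L (U t)) t := by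
    intro t
    have h := (hSd t).clm_apply (hg.integral_hasStrictDerivAt 0 t).hasDerivAt
    convert h using 1
    have := congrArg (fun M : E →L[ℝ] E => M (L (U t))) (hSS t)
    simp only [mul_apply_eq_comp, one_apply_eq_self] at this
    simp [hξ, this]
  have hξc : Continuous ξ := continuous_iff_continuousAt.2 fun t => (hξd t).continuousAt
  refine ⟨fun t => ξ t + U t, hξc.add hUc, fun t => ?_⟩
  have hc : Continuous fun s => L (ξ s) + L (U s) :=
    (L.continuous.comp hξc).add (L.continuous.comp hUc)
  have h := intervalIntegral.integral_eq_sub_of_hasDerivAt (a := 0) (b := t)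
    (fun s _ => hξd s) (hc.intervalIntegrable _ _)
  have h0 : ξ 0 = 0 := by simp [hξ]
  rw [h0, sub_zero] at h
  simp only [map_add]
  rw [intervalIntegral.integral_add (hc.intervalIntegrable _ _) (hf _ _), h]

/-- Existence of trajectories from the zero state for locally integrable inputs. -/
theorem exists_isTrajectory {ι κ : Type*} [Fintype ι] [Fintype κ] (A : Matrix ι ι ℝ)
    (B : Matrix ι κ ℝ) {u : ℝ → κ → ℝ} (hu : ∀ t, 0 ≤ t → IntervalIntegrable u volume 0 t) :
    ∃ x, IsTrajectory A B u 0 x := by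
  classical
  -- The existence result asks for integrability on every interval, whereas `u` is controlled only
  -- for positive times.
  set v : ℝ → κ → ℝ := Set.indicator (Set.Ioi 0) u with hv
  have hv0 : ∀ t, IntervalIntegrable v volume 0 t := by
    intro t
    rcases le_total 0 t with ht | ht
    · refine (hu t ht).congr fun s hs => ?_
      rw [Set.uIoc_of_le ht] at hs
      rw [hv, Set.indicator_of_mem]; exact hs.1
    · refine (IntervalIntegrable.zero (E := κ → ℝ) (μ := volume)).congr fun s hs => ?_
      rw [Set.uIoc_of_ge ht] at hs
      rw [hv, Set.indicator_of_notMem]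
      · rfl
      · simpa using hs.2
  obtain ⟨x, hxc, hx⟩ := exists_eq_integral_clm_add (Matrix.toLin' A).toContinuousLinearMap
    (f := fun t => B *ᵥ v t) fun a b =>
      intervalIntegrable_mulVec B ((hv0 a).symm.trans (hv0 b))
  have hAx : Continuous fun t => A *ᵥ x t := by fun_prop
  refine ⟨x, hxc.continuousOn, fun t ht => (hAx.intervalIntegrable _ _).add
    (intervalIntegrable_mulVec B (hu t ht)), fun t ht => ?_⟩
  rw [hx t, zero_add]
  apply intervalIntegral.integral_congr_ae
  refine Filter.Eventually.of_forall fun s hs => ?_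
  rw [Set.uIoc_of_le ht] at hs
  have : v s = u s := by rw [hv, Set.indicator_of_mem]; exact hs.1
  simp [this]

/-! ### Dissipation inequalities. -/

section

variable {ι κ ρ η : Type*} [Fintype ι] [Fintype κ] [Fintype ρ] [Fintype η]

theorem dotProduct_self_nonneg' (v : ι → ℝ) : 0 ≤ v ⬝ᵥ v :=
  Finset.sum_nonneg fun i _ => mul_self_nonneg (v i)

theorem dotProduct_mulVec_eq_transpose (M : Matrix ι κ ℝ) (v : ι → ℝ) (w : κ → ℝ) :
    v ⬝ᵥ M *ᵥ w = (Mᵀ *ᵥ v) ⬝ᵥ w := by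
  rw [dotProduct_mulVec, mulVec_transpose]

/-- Pairing the Lyapunov equation with `z` shows that the storage `zᵀ M z` decays at the rate `|C
z|²` along the free motion. -/
theorem mulVec_dotProduct_mulVec_of_lyapunov {A M : Matrix ι ι ℝ} {C : Matrix η ι ℝ}
    (hM : Mᵀ = M) (h : Aᵀ * M + M * A + Cᵀ * C = 0) (z : ι → ℝ) :
    2 * ((A *ᵥ z) ⬝ᵥ M *ᵥ z) = -((C *ᵥ z) ⬝ᵥ (C *ᵥ z)) := by
  have h1 : z ⬝ᵥ (Aᵀ * M + M * A + Cᵀ * C) *ᵥ z = 0 := by rw [h]; simp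
  rw [add_mulVec, add_mulVec, dotProduct_add, dotProduct_add, ← mulVec_mulVec, ← mulVec_mulVec,
    ← mulVec_mulVec, dotProduct_mulVec_eq_transpose Aᵀ, dotProduct_mulVec_eq_transpose Cᵀ,
    dotProduct_mulVec_eq_transpose M z, hM, transpose_transpose, transpose_transpose,
    dotProduct_comm (M *ᵥ z)] at h1
  linarith

theorem intervalIntegrable_output {f x : ℝ → ι → ℝ} (C : Matrix η ι ℝ) (hx : IsPrimitive f x)
    {T : ℝ} (hT : 0 ≤ T) :
    IntervalIntegrable (fun t => (C *ᵥ x t) ⬝ᵥ (C *ᵥ x t)) volume 0 T := by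
  have hc := (hx.mulVec C).continuousOn hT
  exact intervalIntegrable_dotProduct hc.intervalIntegrable hc

/-- A projection whose defect is annihilated by the observability Gramian reproduces the output. -/
theorem integral_error_nonpos_of_unobservable_defect [DecidableEq ι] {A Q : Matrix ι ι ℝ}
    {B : Matrix ι κ ℝ} {C : Matrix η ι ℝ} {L : Matrix ι ι ℝ} {V W : Matrix ι ρ ℝ}
    (hQ : Aᵀ * Q + Q * A + Cᵀ * C = 0) (hL : Q = L * Lᵀ)
    (hB : Lᵀ * (1 - V * Wᵀ) * B = 0) (hAV : Lᵀ * (1 - V * Wᵀ) * A * V = 0)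
    {u : ℝ → κ → ℝ} {x : ℝ → ι → ℝ} {xr : ℝ → ρ → ℝ}
    (hx : IsTrajectory A B u 0 x) (hxr : IsTrajectory (Wᵀ * A * V) (Wᵀ * B) u 0 xr)
    {T : ℝ} (hT : 0 ≤ T) :
    ∫ t in (0 : ℝ)..T, (C *ᵥ (x t - V *ᵥ xr t)) ⬝ᵥ (C *ᵥ (x t - V *ᵥ xr t)) ≤ 0 := by
  have hQt : Qᵀ = Q := by rw [hL, transpose_mul, transpose_transpose]
  have hLL : ∀ a b, a ⬝ᵥ Q *ᵥ b = (Lᵀ *ᵥ a) ⬝ᵥ (Lᵀ *ᵥ b) := fun a b => by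
    rw [hL, ← mulVec_mulVec, dotProduct_mulVec_eq_transpose]
  have hz := hx.isPrimitive.sub (hxr.isPrimitive.mulVec V)
  obtain ⟨-, hq⟩ := hz.quadratic Q hQt hT
  -- After applying `Lᵀ` the error `z` moves as if it were free, so its storage, zero initially and
  -- nonnegative at `T`, can only dissipate.
  have key : ∀ t, 2 * ((A *ᵥ x t + B *ᵥ u t - V *ᵥ ((Wᵀ * A * V) *ᵥ xr t + (Wᵀ * B) *ᵥ u t)) ⬝ᵥ
      Q *ᵥ (x t - V *ᵥ xr t)) =
      -((C *ᵥ (x t - V *ᵥ xr t)) ⬝ᵥ (C *ᵥ (x t - V *ᵥ xr t))) := by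
    intro t
    rw [← mulVec_dotProduct_mulVec_of_lyapunov hQt hQ]
    congr 1
    rw [hLL, hLL]
    congr 1
    have h1 : Lᵀ *ᵥ (A *ᵥ x t + B *ᵥ u t - V *ᵥ ((Wᵀ * A * V) *ᵥ xr t + (Wᵀ * B) *ᵥ u t)) =
        Lᵀ *ᵥ A *ᵥ (x t - V *ᵥ xr t) + (Lᵀ * (1 - V * Wᵀ) * A * V) *ᵥ xr t +
          (Lᵀ * (1 - V * Wᵀ) * B) *ᵥ u t := by
      simp only [mulVec_add, mulVec_sub, mulVec_mulVec, Matrix.mul_sub, Matrix.sub_mul,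
        sub_mulVec, Matrix.mul_one, Matrix.mul_assoc]
      abel
    rw [h1, hB, hAV]
    simp
  simp only [key] at hq
  rw [intervalIntegral.integral_neg] at hq
  have h0 : 0 ≤ (x T - V *ᵥ xr T) ⬝ᵥ Q *ᵥ (x T - V *ᵥ xr T) := by
    rw [hLL]
    exact dotProduct_self_nonneg' _
  linarith

/-- Dissipation inequality behind the truncation of the states with Hankel singular value `s` of a
balanced system. -/
theorem truncation_dissipation [DecidableEq ι] {A S S' : Matrix ι ι ℝ} {B : Matrix ι κ ℝ}
    {C : Matrix η ι ℝ} {E : Matrix ι ρ ℝ} {s : ℝ} (hs : 0 < s) [DecidableEq ρ]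
    (hSt : Sᵀ = S) (hSt' : S'ᵀ = S') (hSS : S' * S = 1)
    (hc : A * S + S * Aᵀ + B * Bᵀ = 0) (ho : Aᵀ * S + S * A + Cᵀ * C = 0)
    (hE : Eᵀ * E = 1) (hSE : S * (1 - E * Eᵀ) = s • (1 - E * Eᵀ))
    (x : ι → ℝ) (ξ : ρ → ℝ) (u : κ → ℝ) :
    2 * ((A *ᵥ x + B *ᵥ u - E *ᵥ ((Eᵀ * A * E) *ᵥ ξ + (Eᵀ * B) *ᵥ u)) ⬝ᵥ S *ᵥ (x - E *ᵥ ξ)) +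
      s ^ 2 * (2 * ((A *ᵥ x + B *ᵥ u + E *ᵥ ((Eᵀ * A * E) *ᵥ ξ + (Eᵀ * B) *ᵥ u)) ⬝ᵥ
        S' *ᵥ (x + E *ᵥ ξ))) ≤
    (2 * s) ^ 2 * (u ⬝ᵥ u) - (C *ᵥ (x - E *ᵥ ξ)) ⬝ᵥ (C *ᵥ (x - E *ᵥ ξ)) := by
  have hSS' : S * S' = 1 := mul_eq_one_comm.1 hSS
  have hSE' : S' * (1 - E * Eᵀ) = s⁻¹ • (1 - E * Eᵀ) := by
    have : S' * (S * (1 - E * Eᵀ)) = s • (S' * (1 - E * Eᵀ)) := by rw [hSE, Matrix.mul_smul]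
    rw [← Matrix.mul_assoc, hSS, Matrix.one_mul] at this
    conv_rhs => rw [this, smul_smul, inv_mul_cancel₀ hs.ne', one_smul]
  -- Multiplying the controllability equation by `S⁻¹` on both sides turns it into an observability
  -- equation with output matrix `Bᵀ S⁻¹`.
  have hc' : Aᵀ * S' + S' * A + (Bᵀ * S')ᵀ * (Bᵀ * S') = 0 := by
    have h1 : S' * (A * S + S * Aᵀ + B * Bᵀ) * S' = 0 := by rw [hc]; simp
    have h2 : S' * (A * S + S * Aᵀ + B * Bᵀ) * S' =
        S' * A * (S * S') + (S' * S) * Aᵀ * S' + S' * B * Bᵀ * S' := by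
      simp only [Matrix.mul_add, Matrix.add_mul, Matrix.mul_assoc]
    rw [h2, hSS, hSS', Matrix.mul_one, Matrix.one_mul] at h1
    rw [transpose_mul, transpose_transpose, hSt', ← Matrix.mul_assoc, ← h1]
    abel
  set N : Matrix ι ι ℝ := 1 - E * Eᵀ with hN
  have hNt : Nᵀ = N := by
    rw [hN, transpose_sub, transpose_one, transpose_mul, transpose_transpose]
  have hNE : N * E = 0 := by
    rw [hN, Matrix.sub_mul, Matrix.one_mul, Matrix.mul_assoc, hE, Matrix.mul_one, sub_self]
  -- The residual of the reduced dynamics drives `z` with sign `+` and `w` with sign `-`. It lies in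
  -- the range of `N`, where `S` acts as `s` and `S⁻¹` as `s⁻¹`, and is orthogonal to `E ξ`; with
  -- the weight `s²` its two contributions cancel.
  set h : ι → ℝ := N *ᵥ (A *ᵥ E *ᵥ ξ + B *ᵥ u) with hh
  set z := x - E *ᵥ ξ with hz
  set w := x + E *ᵥ ξ with hw
  have hfz : A *ᵥ x + B *ᵥ u - E *ᵥ ((Eᵀ * A * E) *ᵥ ξ + (Eᵀ * B) *ᵥ u) = A *ᵥ z + h := by
    rw [hh, hN, hz]
    simp only [mulVec_add, mulVec_sub, mulVec_mulVec, Matrix.sub_mul, Matrix.one_mul,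
      sub_mulVec, Matrix.mul_assoc]
    abel
  have hfw : A *ᵥ x + B *ᵥ u + E *ᵥ ((Eᵀ * A * E) *ᵥ ξ + (Eᵀ * B) *ᵥ u) =
      A *ᵥ w + (2 : ℝ) • (B *ᵥ u) - h := by
    rw [hh, hN, hw, two_smul]
    simp only [mulVec_add, mulVec_mulVec, Matrix.sub_mul, Matrix.one_mul,
      sub_mulVec, Matrix.mul_assoc]
    abel
  have e1 : h ⬝ᵥ S *ᵥ z = s * (h ⬝ᵥ z) := by
    rw [dotProduct_mulVec_eq_transpose, hSt, hh, mulVec_mulVec, hSE, smul_mulVec, smul_dotProduct,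
      smul_eq_mul]
  have e2 : h ⬝ᵥ S' *ᵥ w = s⁻¹ * (h ⬝ᵥ w) := by
    rw [dotProduct_mulVec_eq_transpose, hSt', hh, mulVec_mulVec, hSE', smul_mulVec,
      smul_dotProduct, smul_eq_mul]
  have e3 : h ⬝ᵥ w = h ⬝ᵥ z := by
    have : h ⬝ᵥ E *ᵥ ξ = 0 := by
      rw [hh, dotProduct_comm, dotProduct_mulVec_eq_transpose, hNt, mulVec_mulVec, hNE]
      simp
    rw [hw, hz, dotProduct_add, dotProduct_sub, this]; simp
  have e4 := mulVec_dotProduct_mulVec_of_lyapunov hSt ho z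
  have e5 := mulVec_dotProduct_mulVec_of_lyapunov hSt' hc' w
  have e6 : (B *ᵥ u) ⬝ᵥ S' *ᵥ w = u ⬝ᵥ (Bᵀ * S') *ᵥ w := by
    rw [← mulVec_mulVec, dotProduct_mulVec_eq_transpose Bᵀ, transpose_transpose]
  -- Completing the square: `4 u ⬝ g - |g|² ≤ 4 |u|²` for `g = Bᵀ S⁻¹ w`, which is the source of the
  -- constant `(2 s)²`.
  have e7 := dotProduct_self_nonneg' ((Bᵀ * S') *ᵥ w - (2 : ℝ) • u)
  rw [sub_dotProduct, dotProduct_sub, dotProduct_sub, smul_dotProduct, dotProduct_smul,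
    smul_dotProduct, dotProduct_smul, dotProduct_comm _ u] at e7
  simp only [smul_eq_mul] at e7
  rw [hfz, hfw, add_dotProduct, sub_dotProduct, add_dotProduct, smul_dotProduct, e1, e2, e3, e6,
    mul_add, e4, smul_eq_mul]
  have e8 : s ^ 2 * (s⁻¹ * (h ⬝ᵥ z)) = s * (h ⬝ᵥ z) := by field_simp
  have e9 : s ^ 2 * (2 * ((A *ᵥ w) ⬝ᵥ S' *ᵥ w)) =
    s ^ 2 * -(((Bᵀ * S') *ᵥ w) ⬝ᵥ ((Bᵀ * S') *ᵥ w)) := by rw [e5]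
  have e10 := mul_nonneg (sq_nonneg s) e7
  linarith

/-- Truncating the states with Hankel singular value `s` of a balanced system causes an error of
`𝕃₂`-gain at most `2 s`. -/
theorem integral_error_le_of_truncation [DecidableEq ι] [DecidableEq ρ] {A S S' : Matrix ι ι ℝ}
    {B : Matrix ι κ ℝ} {C : Matrix η ι ℝ} {E : Matrix ι ρ ℝ} {s : ℝ} (hs : 0 < s)
    (hSt : Sᵀ = S) (hSt' : S'ᵀ = S') (hSS : S' * S = 1)
    (hSn : ∀ z, 0 ≤ z ⬝ᵥ S *ᵥ z) (hSn' : ∀ z, 0 ≤ z ⬝ᵥ S' *ᵥ z)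
    (hc : A * S + S * Aᵀ + B * Bᵀ = 0) (ho : Aᵀ * S + S * A + Cᵀ * C = 0)
    (hE : Eᵀ * E = 1) (hSE : S * (1 - E * Eᵀ) = s • (1 - E * Eᵀ))
    {u : ℝ → κ → ℝ} {x : ℝ → ι → ℝ} {xr : ℝ → ρ → ℝ}
    (hx : IsTrajectory A B u 0 x) (hxr : IsTrajectory (Eᵀ * A * E) (Eᵀ * B) u 0 xr)
    {T : ℝ} (hT : 0 ≤ T) (hu : IntervalIntegrable (fun t => u t ⬝ᵥ u t) volume 0 T) :
    ∫ t in (0 : ℝ)..T, (C *ᵥ (x t - E *ᵥ xr t)) ⬝ᵥ (C *ᵥ (x t - E *ᵥ xr t)) ≤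
      (2 * s) ^ 2 * ∫ t in (0 : ℝ)..T, u t ⬝ᵥ u t := by
  have hz := hx.isPrimitive.sub (hxr.isPrimitive.mulVec E)
  have hw := hx.isPrimitive.add (hxr.isPrimitive.mulVec E)
  obtain ⟨iz, qz⟩ := hz.quadratic S hSt hT
  obtain ⟨iw, qw⟩ := hw.quadratic S' hSt' hT
  have ie := intervalIntegrable_output C hz hT
  have h := intervalIntegral.integral_mono_on hT (iz.add (iw.const_mul (s ^ 2)))
    ((hu.const_mul ((2 * s) ^ 2)).sub ie)
    fun t _ => truncation_dissipation hs hSt hSt' hSS hc ho hE hSE (x t) (xr t) (u t)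
  rw [intervalIntegral.integral_add iz (iw.const_mul (s ^ 2)),
    intervalIntegral.integral_sub (hu.const_mul _) ie,
    intervalIntegral.integral_const_mul (s ^ 2), intervalIntegral.integral_const_mul ((2 * s) ^ 2),
    ← qz, ← qw] at h
  have h1 := hSn (x T - E *ᵥ xr T)
  have h2 := mul_nonneg (sq_nonneg s) (hSn' (x T + E *ᵥ xr T))
  linarith

end

/-! ### Coordinate inclusions and diagonal matrices. -/

/-- The `r`-dimensional coordinate subspace of `ℝⁿ`. -/
def incl {r n : ℕ} (h : r ≤ n) : Matrix (Fin n) (Fin r) ℝ :=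
  (1 : Matrix (Fin n) (Fin n) ℝ).submatrix id (Fin.castLE h)

/-- The leading `r × r` diagonal matrix of a sequence. -/
def diagSeq (r : ℕ) (f : ℕ → ℝ) : Matrix (Fin r) (Fin r) ℝ :=
  Matrix.diagonal fun i => f i

section

variable {r s n : ℕ}

theorem submatrix_eq_mul_incl {ι : Type*} (M : Matrix ι (Fin n) ℝ) (h : r ≤ n) :
    M.submatrix id (Fin.castLE h) = M * incl h := by
  rw [incl]
  ext i j
  simp [Matrix.mul_apply, Matrix.one_apply]

theorem incl_mul_incl (h : r ≤ s) (h' : s ≤ n) : incl h' * incl h = incl (h.trans h') := by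
  rw [← submatrix_eq_mul_incl]
  rfl

theorem incl_apply (h : r ≤ n) (i : Fin n) (j : Fin r) :
    incl h i j = if (i : ℕ) = j then 1 else 0 := by
  simp [incl, Matrix.one_apply, Fin.ext_iff]

theorem incl_transpose_mul_self (h : r ≤ n) : (incl h)ᵀ * incl h = 1 := by
  rw [← submatrix_eq_mul_incl]
  ext i j
  simp [incl_apply, Matrix.one_apply, Fin.ext_iff, eq_comm]

theorem incl_mul_transpose (h : r ≤ n) :
    incl h * (incl h)ᵀ = diagSeq n fun i => if i < r then 1 else 0 := by
  ext i j
  simp only [Matrix.mul_apply, transpose_apply, incl_apply, diagSeq, Matrix.diagonal_apply]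
  by_cases hi : (i : ℕ) < r
  · rw [Finset.sum_eq_single (⟨i, hi⟩ : Fin r)]
    · simp [hi, Fin.ext_iff, eq_comm]
    · intro b _ hb
      have : (i : ℕ) ≠ b := fun h => hb (Fin.ext h.symm)
      simp [this]
    · simp
  · rw [Finset.sum_eq_zero]
    · simp [hi]
    · intro b _
      have : (i : ℕ) ≠ b := fun h => hi (h ▸ b.2)
      simp [this]

theorem diagSeq_mul_incl (f : ℕ → ℝ) (h : r ≤ n) : diagSeq n f * incl h = incl h * diagSeq r f := by
  ext i j
  simp only [diagSeq, Matrix.diagonal_mul, Matrix.mul_diagonal, incl_apply]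
  split_ifs with hij
  · rw [hij]; ring
  · simp

theorem diagSeq_mul_diagSeq (f g : ℕ → ℝ) :
    diagSeq r f * diagSeq r g = diagSeq r fun i => f i * g i := by
  simp [diagSeq]

theorem diagSeq_transpose (f : ℕ → ℝ) : (diagSeq r f)ᵀ = diagSeq r f := by
  simp [diagSeq]

theorem diagSeq_congr {f g : ℕ → ℝ} (h : ∀ i, i < r → f i = g i) : diagSeq r f = diagSeq r g := by
  simp only [diagSeq]
  congr 1
  ext i
  exact h i i.2

theorem diagSeq_one : diagSeq r (fun _ => 1) = 1 := by
  simp [diagSeq]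

theorem diagSeq_nonneg {f : ℕ → ℝ} (hf : ∀ i, i < r → 0 ≤ f i) (z : Fin r → ℝ) :
    0 ≤ z ⬝ᵥ diagSeq r f *ᵥ z := by
  simp only [dotProduct, diagSeq, mulVec_diagonal]
  refine Finset.sum_nonneg fun i _ => ?_
  have := mul_nonneg (hf i i.2) (mul_self_nonneg (z i))
  linarith

end

/-! ### Algebra of the square-root method. -/

/-- Gramians, their factors and the singular value decomposition from which balanced truncations of
every order are formed. -/
structure IsBalancingData {n m p : ℕ} (A : Matrix (Fin n) (Fin n) ℝ) (B : Matrix (Fin n) (Fin m) ℝ)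
    (C : Matrix (Fin p) (Fin n) ℝ) (σ : ℕ → ℝ) (P Q R L U Z : Matrix (Fin n) (Fin n) ℝ) : Prop where
  ctrl : A * P + P * Aᵀ + B * Bᵀ = 0
  obs : Aᵀ * Q + Q * A + Cᵀ * C = 0
  eqP : P = R * Rᵀ
  eqQ : Q = L * Lᵀ
  orthU : Uᵀ * U = 1
  orthZ : Zᵀ * Z = 1
  svd : Lᵀ * R = U * diagSeq n (fun i => σ (i + 1)) * Zᵀ
  nonneg : ∀ i, 0 ≤ σ i
  antitone : ∀ i j, 1 ≤ i → i ≤ j → σ j ≤ σ i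
  eq_zero : ∀ i, n < i → σ i = 0

/-- The projection matrix `R Z_r Σ_r^{-1/2}`. -/
noncomputable def projMatrix {n r : ℕ} (R Z : Matrix (Fin n) (Fin n) ℝ) (σ : ℕ → ℝ) (h : r ≤ n) :
    Matrix (Fin n) (Fin r) ℝ :=
  R * (Z * (incl h * diagSeq r fun i => (Real.sqrt (σ (i + 1)))⁻¹))

theorem IsBalancedTruncation.exists_data {n m p r : ℕ} {A : Matrix (Fin n) (Fin n) ℝ}
    {B : Matrix (Fin n) (Fin m) ℝ} {C : Matrix (Fin p) (Fin n) ℝ} {V W : Matrix (Fin n) (Fin r) ℝ}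
    {σ : ℕ → ℝ} (h : IsBalancedTruncation A B C r V W σ) :
    ∃ hr : r ≤ n, ∃ P Q R L U Z, IsBalancingData A B C σ P Q R L U Z ∧
      V = projMatrix R Z σ hr ∧ W = projMatrix L U σ hr := by
  obtain ⟨hr, P, Q, R, L, U, Z, h1, h2, h3, h4, h5, h6, h7, h8, h9, h10, h11, h12⟩ := h
  refine ⟨hr, P, Q, R, L, U, Z, ⟨h1, h2, h3, h4, ?_, ?_, h7, h8, h9, h10⟩, ?_, ?_⟩
  · exact (mem_orthogonalGroup_iff' (Fin n) ℝ).1 h5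
  · exact (mem_orthogonalGroup_iff' (Fin n) ℝ).1 h6
  · rw [h11, submatrix_eq_mul_incl, projMatrix]
    simp only [Matrix.mul_assoc, diagSeq]
  · rw [h12, submatrix_eq_mul_incl, projMatrix]
    simp only [Matrix.mul_assoc, diagSeq]

section

variable {r s n m p : ℕ}

theorem diagSeq_comm (f g : ℕ → ℝ) : diagSeq r f * diagSeq r g = diagSeq r g * diagSeq r f := by
  rw [diagSeq_mul_diagSeq, diagSeq_mul_diagSeq]
  exact diagSeq_congr fun i _ => mul_comm _ _

/-- Truncations of different orders from the same factors are nested, so states can be removed one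
by one. -/
theorem projMatrix_eq_mul_incl (R Z : Matrix (Fin n) (Fin n) ℝ) (σ : ℕ → ℝ) (h : r ≤ s)
    (h' : s ≤ n) : projMatrix R Z σ (h.trans h') = projMatrix R Z σ h' * incl h := by
  simp only [projMatrix, Matrix.mul_assoc, diagSeq_mul_incl]
  simp only [← Matrix.mul_assoc (incl h'), incl_mul_incl]

variable {A : Matrix (Fin n) (Fin n) ℝ} {B : Matrix (Fin n) (Fin m) ℝ}
  {C : Matrix (Fin p) (Fin n) ℝ} {σ : ℕ → ℝ} {P Q R L U Z : Matrix (Fin n) (Fin n) ℝ}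

namespace IsBalancingData

theorem svd' (h : IsBalancingData A B C σ P Q R L U Z) :
    Rᵀ * L = Z * (diagSeq n (fun i => σ (i + 1)) * Uᵀ) := by
  have := congrArg transpose h.svd
  rwa [transpose_mul, transpose_mul, transpose_mul, transpose_transpose, transpose_transpose,
    diagSeq_transpose] at this

theorem symm_P (h : IsBalancingData A B C σ P Q R L U Z) : Pᵀ = P := by
  rw [h.eqP, transpose_mul, transpose_transpose]

theorem symm_Q (h : IsBalancingData A B C σ P Q R L U Z) : Qᵀ = Q := by
  rw [h.eqQ, transpose_mul, transpose_transpose]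

theorem L_mul_V (h : IsBalancingData A B C σ P Q R L U Z) (hr : r ≤ n) :
    Lᵀ * projMatrix R Z σ hr = U * (incl hr * (diagSeq r (fun i => σ (i + 1)) *
      diagSeq r fun i => (Real.sqrt (σ (i + 1)))⁻¹)) := by
  rw [projMatrix, ← Matrix.mul_assoc, h.svd, Matrix.mul_assoc, ← Matrix.mul_assoc Zᵀ, h.orthZ,
    Matrix.one_mul, Matrix.mul_assoc, ← Matrix.mul_assoc (diagSeq n _), diagSeq_mul_incl,
    Matrix.mul_assoc]

theorem R_mul_W (h : IsBalancingData A B C σ P Q R L U Z) (hr : r ≤ n) :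
    Rᵀ * projMatrix L U σ hr = Z * (incl hr * (diagSeq r (fun i => σ (i + 1)) *
      diagSeq r fun i => (Real.sqrt (σ (i + 1)))⁻¹)) := by
  rw [projMatrix, ← Matrix.mul_assoc, h.svd', Matrix.mul_assoc, Matrix.mul_assoc,
    ← Matrix.mul_assoc Uᵀ, h.orthU,
    Matrix.one_mul, ← Matrix.mul_assoc (diagSeq n _), diagSeq_mul_incl,
    Matrix.mul_assoc]

theorem Q_mul_V (h : IsBalancingData A B C σ P Q R L U Z) (hr : r ≤ n) :
    Q * projMatrix R Z σ hr = projMatrix L U σ hr * diagSeq r fun i => σ (i + 1) := by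
  rw [h.eqQ, Matrix.mul_assoc, h.L_mul_V, projMatrix, diagSeq_comm]
  simp only [Matrix.mul_assoc]

theorem P_mul_W (h : IsBalancingData A B C σ P Q R L U Z) (hr : r ≤ n) :
    P * projMatrix L U σ hr = projMatrix R Z σ hr * diagSeq r fun i => σ (i + 1) := by
  rw [h.eqP, Matrix.mul_assoc, h.R_mul_W, projMatrix, diagSeq_comm]
  simp only [Matrix.mul_assoc]

/-- The decomposition of `Lᵀ R` reduces the product to `Σ^{-1/2} Σ Σ^{-1/2}`; positivity is needed
to cancel the roots. -/
theorem W_mul_V (h : IsBalancingData A B C σ P Q R L U Z) (hr : r ≤ n)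
    (hpos : ∀ i, i < r → 0 < σ (i + 1)) :
    (projMatrix L U σ hr)ᵀ * projMatrix R Z σ hr = 1 := by
  rw [projMatrix, transpose_mul, Matrix.mul_assoc, h.L_mul_V, transpose_mul, transpose_mul,
    diagSeq_transpose, Matrix.mul_assoc, Matrix.mul_assoc, ← Matrix.mul_assoc Uᵀ, h.orthU,
    Matrix.one_mul, ← Matrix.mul_assoc (incl hr)ᵀ, incl_transpose_mul_self, Matrix.one_mul,
    diagSeq_mul_diagSeq, diagSeq_mul_diagSeq, ← diagSeq_one]
  refine diagSeq_congr fun i hi => ?_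
  have h1 := Real.mul_self_sqrt (hpos i hi).le
  have h2 : Real.sqrt (σ (i + 1)) ≠ 0 := (Real.sqrt_pos.2 (hpos i hi)).ne'
  field_simp
  nlinarith

/-- Compressing the Lyapunov equation by `Wᵀ` and `W` and inserting `P W = V Σ` shows that the
truncated model inherits a diagonal Gramian; `reduced_obs` is dual and yields the same one. -/
theorem reduced_ctrl (h : IsBalancingData A B C σ P Q R L U Z) (hr : r ≤ n)
    {V W : Matrix (Fin n) (Fin r) ℝ}
    (hV : V = projMatrix R Z σ hr) (hW : W = projMatrix L U σ hr) :
    (Wᵀ * A * V) * diagSeq r (fun i => σ (i + 1)) +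
      diagSeq r (fun i => σ (i + 1)) * (Wᵀ * A * V)ᵀ + (Wᵀ * B) * (Wᵀ * B)ᵀ = 0 := by
  have hPW : P * W = V * diagSeq r fun i => σ (i + 1) := by rw [hV, hW, h.P_mul_W]
  have hWP : Wᵀ * P = diagSeq r (fun i => σ (i + 1)) * Vᵀ := by
    rw [← h.symm_P, ← transpose_mul, hPW, transpose_mul, diagSeq_transpose]
  have h1 : Wᵀ * (A * P + P * Aᵀ + B * Bᵀ) * W = 0 := by rw [h.ctrl]; simp
  have h2 : Wᵀ * (A * P + P * Aᵀ + B * Bᵀ) * W =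
      Wᵀ * A * (P * W) + (Wᵀ * P) * Aᵀ * W + Wᵀ * B * (Bᵀ * W) := by
    simp only [Matrix.mul_add, Matrix.add_mul, Matrix.mul_assoc]
  rw [h2, hPW, hWP] at h1
  rw [← h1]
  simp only [transpose_mul, transpose_transpose, Matrix.mul_assoc]

theorem reduced_obs (h : IsBalancingData A B C σ P Q R L U Z) (hr : r ≤ n)
    {V W : Matrix (Fin n) (Fin r) ℝ}
    (hV : V = projMatrix R Z σ hr) (hW : W = projMatrix L U σ hr) :
    (Wᵀ * A * V)ᵀ * diagSeq r (fun i => σ (i + 1)) +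
      diagSeq r (fun i => σ (i + 1)) * (Wᵀ * A * V) + (C * V)ᵀ * (C * V) = 0 := by
  have hQV : Q * V = W * diagSeq r fun i => σ (i + 1) := by rw [hV, hW, h.Q_mul_V]
  have hVQ : Vᵀ * Q = diagSeq r (fun i => σ (i + 1)) * Wᵀ := by
    rw [← h.symm_Q, ← transpose_mul, hQV, transpose_mul, diagSeq_transpose]
  have h1 : Vᵀ * (Aᵀ * Q + Q * A + Cᵀ * C) * V = 0 := by rw [h.obs]; simp
  have h2 : Vᵀ * (Aᵀ * Q + Q * A + Cᵀ * C) * V =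
      Vᵀ * Aᵀ * (Q * V) + (Vᵀ * Q) * A * V + Vᵀ * Cᵀ * (C * V) := by
    simp only [Matrix.mul_add, Matrix.add_mul, Matrix.mul_assoc]
  rw [h2, hQV, hVQ] at h1
  rw [← h1]
  simp only [transpose_mul, transpose_transpose, Matrix.mul_assoc]

/-- When the discarded singular values are zero, the leading `r` terms of the decomposition already
make up all of `Lᵀ R`. This covers singular Gramians. -/
theorem L_mul_defect_mul_R (h : IsBalancingData A B C σ P Q R L U Z) (hr : r ≤ n)
    (hpos : ∀ i, i < r → 0 < σ (i + 1)) (hzero : σ (r + 1) = 0) :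
    Lᵀ * (1 - projMatrix R Z σ hr * (projMatrix L U σ hr)ᵀ) * R = 0 := by
  have hz : ∀ i, r ≤ i → σ (i + 1) = 0 := fun i hi =>
    le_antisymm (hzero ▸ h.antitone (r + 1) (i + 1) (by lia) (by lia)) (h.nonneg _)
  have hWR : (projMatrix L U σ hr)ᵀ * R = (diagSeq r (fun i => (Real.sqrt (σ (i + 1)))⁻¹) *
      diagSeq r fun i => σ (i + 1)) * ((incl hr)ᵀ * Zᵀ) := by
    have := congrArg transpose (h.R_mul_W hr)
    rw [transpose_mul, transpose_transpose] at this
    rw [this]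
    simp only [transpose_mul, diagSeq_transpose, Matrix.mul_assoc]
  have hD : (diagSeq r (fun i => σ (i + 1)) * diagSeq r fun i => (Real.sqrt (σ (i + 1)))⁻¹) *
      (diagSeq r (fun i => (Real.sqrt (σ (i + 1)))⁻¹) * diagSeq r fun i => σ (i + 1)) =
      diagSeq r fun i => σ (i + 1) := by
    simp only [diagSeq_mul_diagSeq]
    refine diagSeq_congr fun i hi => ?_
    have h1 := Real.mul_self_sqrt (hpos i hi).le
    have h2 : Real.sqrt (σ (i + 1)) ≠ 0 := (Real.sqrt_pos.2 (hpos i hi)).ne'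
    field_simp
    nlinarith
  have hI : incl hr * (diagSeq r (fun i => σ (i + 1)) * (incl hr)ᵀ) =
      diagSeq n fun i => σ (i + 1) := by
    rw [← Matrix.mul_assoc, ← diagSeq_mul_incl, Matrix.mul_assoc, incl_mul_transpose,
      diagSeq_mul_diagSeq]
    refine diagSeq_congr fun i _ => ?_
    split_ifs with hi
    · ring
    · rw [hz i (not_lt.1 hi)]; ring
  have : Lᵀ * projMatrix R Z σ hr * ((projMatrix L U σ hr)ᵀ * R) = Lᵀ * R := by
    rw [h.L_mul_V, hWR, h.svd]
    calc _ = U * (incl hr * (((diagSeq r (fun i => σ (i + 1)) *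
          diagSeq r fun i => (Real.sqrt (σ (i + 1)))⁻¹) *
        (diagSeq r (fun i => (Real.sqrt (σ (i + 1)))⁻¹) * diagSeq r fun i => σ (i + 1))) *
          (incl hr)ᵀ)) * Zᵀ := by simp only [Matrix.mul_assoc]
      _ = _ := by rw [hD, hI]
  rw [Matrix.mul_sub, Matrix.mul_one, Matrix.sub_mul, sub_eq_zero, ← this]
  simp only [Matrix.mul_assoc]

/-- The range of a controllability Gramian contains the range of `B` and is `A`-invariant. -/
theorem annihilates_reachable (h : IsBalancingData A B C σ P Q R L U Z)
    {K : Matrix (Fin n) (Fin n) ℝ} (hK : K * R = 0) : K * B = 0 ∧ K * A * R = 0 := by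
  have hKP : K * P = 0 := by rw [h.eqP, ← Matrix.mul_assoc, hK, Matrix.zero_mul]
  have hPK : P * Kᵀ = 0 := by rw [← h.symm_P, ← transpose_mul, hKP, transpose_zero]
  have h1 : K * (A * P + P * Aᵀ + B * Bᵀ) * Kᵀ = 0 := by rw [h.ctrl]; simp
  have h2 : K * (A * P + P * Aᵀ + B * Bᵀ) * Kᵀ =
      K * A * (P * Kᵀ) + (K * P) * Aᵀ * Kᵀ + (K * B) * (K * B)ᴴ := by
    rw [conjTranspose_eq_transpose_of_trivial]
    simp only [Matrix.mul_add, Matrix.add_mul, Matrix.mul_assoc, transpose_mul]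
  rw [h2, hKP, hPK] at h1
  simp only [Matrix.mul_zero, Matrix.zero_mul, zero_add] at h1
  -- A matrix with `M Mᴴ = 0` vanishes; the same argument serves for `K A R`, since `R Rᵀ = P` and
  -- `K A P = 0`.
  have hKB : K * B = 0 := self_mul_conjTranspose_eq_zero.1 h1
  refine ⟨hKB, self_mul_conjTranspose_eq_zero.1 ?_⟩
  have h3 : K * (A * P + P * Aᵀ + B * Bᵀ) = 0 := by rw [h.ctrl]; simp
  rw [Matrix.mul_add, Matrix.mul_add, ← Matrix.mul_assoc K P, hKP, ← Matrix.mul_assoc K B, hKB,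
    Matrix.zero_mul, Matrix.zero_mul, add_zero, add_zero] at h3
  calc K * A * R * (K * A * R)ᴴ = K * (A * P) * (K * A)ᵀ := by
        rw [conjTranspose_eq_transpose_of_trivial, h.eqP]
        simp only [transpose_mul, Matrix.mul_assoc]
    _ = 0 := by rw [h3, Matrix.zero_mul]

end IsBalancingData

end

/-! ### Euclidean `L₂` norms. -/

section

variable {κ : Type*} [Fintype κ] {μ : Measure ℝ}

theorem norm_toLp_sq (v : κ → ℝ) : ‖WithLp.toLp 2 v‖ ^ 2 = v ⬝ᵥ v := by
  rw [EuclideanSpace.real_norm_sq_eq]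
  simp [dotProduct, sq]

theorem eLpNorm_toLp_eq {g : ℝ → κ → ℝ} (hg : MemLp (fun t => WithLp.toLp 2 (g t)) 2 μ) :
    eLpNorm (fun t => WithLp.toLp 2 (g t)) 2 μ =
      ENNReal.ofReal (Real.sqrt (∫ t, g t ⬝ᵥ g t ∂μ)) := by
  rw [hg.eLpNorm_eq_integral_rpow_norm (by simp) (by simp), Real.sqrt_eq_rpow]
  simp [norm_toLp_sq]

theorem integrable_dotProduct_self {g : ℝ → κ → ℝ}
    (hg : MemLp (fun t => WithLp.toLp 2 (g t)) 2 μ) : Integrable (fun t => g t ⬝ᵥ g t) μ := by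
  simpa [norm_toLp_sq] using hg.integrable_norm_pow (by simp)

theorem eLpNorm_toLp_le_of_integral_le {η : Type*} [Fintype η] {g : ℝ → η → ℝ} {u : ℝ → κ → ℝ}
    (hg : MemLp (fun t => WithLp.toLp 2 (g t)) 2 μ) (hu : MemLp (fun t => WithLp.toLp 2 (u t)) 2 μ)
    {c : ℝ} (hc : 0 ≤ c) (h : ∫ t, g t ⬝ᵥ g t ∂μ ≤ c ^ 2 * ∫ t, u t ⬝ᵥ u t ∂μ) :
    eLpNorm (fun t => WithLp.toLp 2 (g t)) 2 μ ≤
      ENNReal.ofReal c * eLpNorm (fun t => WithLp.toLp 2 (u t)) 2 μ := by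
  rw [eLpNorm_toLp_eq hg, eLpNorm_toLp_eq hu, ← ENNReal.ofReal_mul hc]
  apply ENNReal.ofReal_le_ofReal
  calc _ ≤ Real.sqrt (c ^ 2 * ∫ t, u t ⬝ᵥ u t ∂μ) := Real.sqrt_le_sqrt h
    _ = _ := by rw [Real.sqrt_mul (sq_nonneg c), Real.sqrt_sq hc]

theorem memLp_toLp_of_continuousOn {g : ℝ → κ → ℝ} {T : ℝ}
    (hg : ContinuousOn g (Set.Icc 0 T)) :
    MemLp (fun t => WithLp.toLp 2 (g t)) 2 (volume.restrict (Set.Ioc 0 T)) := by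
  have hc : ContinuousOn (fun t => WithLp.toLp 2 (g t)) (Set.Icc 0 T) :=
    (PiLp.continuous_toLp 2 fun _ : κ => ℝ).comp_continuousOn hg
  have hm : AEStronglyMeasurable (fun t => WithLp.toLp 2 (g t)) (volume.restrict (Set.Ioc 0 T)) :=
    (hc.mono Set.Ioc_subset_Icc_self).aestronglyMeasurable measurableSet_Ioc
  rw [memLp_two_iff_integrable_sq_norm hm]
  exact ((hc.norm.pow 2).integrableOn_compact isCompact_Icc).mono_set Set.Ioc_subset_Icc_self

end

/-! ### Balanced truncation error on finite horizons. -/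

section

variable {n m p : ℕ} {A : Matrix (Fin n) (Fin n) ℝ} {B : Matrix (Fin n) (Fin m) ℝ}
  {C : Matrix (Fin p) (Fin n) ℝ} {σ : ℕ → ℝ} {P Q R L U Z : Matrix (Fin n) (Fin n) ℝ}

theorem IsTrajectory.continuousOn_Icc {ι κ : Type*} [Fintype ι] [Fintype κ]
    {A : Matrix ι ι ℝ} {B : Matrix ι κ ℝ} {u : ℝ → κ → ℝ} {x₀ : ι → ℝ}
    {x : ℝ → ι → ℝ} (h : IsTrajectory A B u x₀ x) (T : ℝ) : ContinuousOn x (Set.Icc 0 T) :=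
  h.continuousOn.mono Set.Icc_subset_Ici_self

theorem continuousOn_mulVec {ι κ : Type*} [Fintype ι] [Fintype κ] (M : Matrix κ ι ℝ)
    {x : ℝ → ι → ℝ} {s : Set ℝ} (hx : ContinuousOn x s) : ContinuousOn (fun t => M *ᵥ x t) s :=
  (Continuous.matrix_mulVec continuous_const continuous_id).comp_continuousOn hx

/-- If all truncated Hankel singular values vanish, the reduced model reproduces the output. -/
theorem IsBalancingData.integral_error_nonpos (h : IsBalancingData A B C σ P Q R L U Z)
    {u : ℝ → Fin m → ℝ} {x : ℝ → Fin n → ℝ} {T : ℝ} (hT : 0 ≤ T) (hx : IsTrajectory A B u 0 x)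
    {r : ℕ} (hr : r ≤ n) (hpos : ∀ i, i < r → 0 < σ (i + 1)) (hzero : σ (r + 1) = 0)
    {V W : Matrix (Fin n) (Fin r) ℝ} (hV : V = projMatrix R Z σ hr) (hW : W = projMatrix L U σ hr)
    {xr : ℝ → Fin r → ℝ} (hxr : IsTrajectory (Wᵀ * A * V) (Wᵀ * B) u 0 xr) :
    ∫ t in (0 : ℝ)..T, (C *ᵥ (x t - V *ᵥ xr t)) ⬝ᵥ (C *ᵥ (x t - V *ᵥ xr t)) ≤ 0 := by
  have hK := h.L_mul_defect_mul_R hr hpos hzero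
  rw [← hV, ← hW] at hK
  obtain ⟨hB, hAR⟩ := h.annihilates_reachable hK
  refine integral_error_nonpos_of_unobservable_defect h.obs h.eqQ hB ?_ hx hxr hT
  -- Only the rightmost `V` is unfolded: it starts with the factor `R`, which `Lᵀ (1 - V Wᵀ) A`
  -- annihilates.
  nth_rw 2 [hV]
  rw [projMatrix, ← Matrix.mul_assoc, hAR, Matrix.zero_mul]

/-- The error norm is zero here, so `K` is left free for the constant the induction requires. -/
theorem IsBalancingData.eLpNorm_error_le_of_eq_zero (h : IsBalancingData A B C σ P Q R L U Z)
    {u : ℝ → Fin m → ℝ} {x : ℝ → Fin n → ℝ} {T : ℝ} (hT : 0 ≤ T)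
    (hu : MemLp (fun t => WithLp.toLp 2 (u t)) 2 (volume.restrict (Set.Ioc 0 T)))
    (hx : IsTrajectory A B u 0 x)
    {r : ℕ} (hr : r ≤ n) (hpos : ∀ i, i < r → 0 < σ (i + 1)) (hzero : σ (r + 1) = 0)
    {V W : Matrix (Fin n) (Fin r) ℝ} (hV : V = projMatrix R Z σ hr) (hW : W = projMatrix L U σ hr)
    {xr : ℝ → Fin r → ℝ} (hxr : IsTrajectory (Wᵀ * A * V) (Wᵀ * B) u 0 xr) (K : ENNReal) :
    eLpNorm (fun t => WithLp.toLp 2 (C *ᵥ (x t - V *ᵥ xr t))) 2 (volume.restrict (Set.Ioc 0 T)) ≤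
      K * eLpNorm (fun t => WithLp.toLp 2 (u t)) 2 (volume.restrict (Set.Ioc 0 T)) := by
  have he := h.integral_error_nonpos hT hx hr hpos hzero hV hW hxr
  rw [intervalIntegral.integral_of_le hT] at he
  have hc := continuousOn_mulVec C
    ((hx.continuousOn_Icc T).sub (continuousOn_mulVec V (hxr.continuousOn_Icc T)))
  refine (eLpNorm_toLp_le_of_integral_le (memLp_toLp_of_continuousOn hc) hu le_rfl
    (by simpa using he)).trans ?_
  simp

/-- Error bound for the truncation of the last state of a balanced model. -/
theorem IsBalancingData.integral_error_succ_le (h : IsBalancingData A B C σ P Q R L U Z)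
    {u : ℝ → Fin m → ℝ} {T : ℝ} (hT : 0 ≤ T)
    (hu : IntervalIntegrable (fun t => u t ⬝ᵥ u t) volume 0 T)
    {r : ℕ} (hr : r + 1 ≤ n) (hpos : ∀ i, i < r + 1 → 0 < σ (i + 1))
    {V W : Matrix (Fin n) (Fin (r + 1)) ℝ} (hV : V = projMatrix R Z σ hr)
    (hW : W = projMatrix L U σ hr) {E : Matrix (Fin (r + 1)) (Fin r) ℝ}
    (hE : E = incl (Nat.le_succ r))
    {x : ℝ → Fin (r + 1) → ℝ} (hx : IsTrajectory (Wᵀ * A * V) (Wᵀ * B) u 0 x)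
    {xr : ℝ → Fin r → ℝ}
    (hxr : IsTrajectory (Eᵀ * (Wᵀ * A * V) * E) (Eᵀ * (Wᵀ * B)) u 0 xr) :
    ∫ t in (0 : ℝ)..T, ((C * V) *ᵥ (x t - E *ᵥ xr t)) ⬝ᵥ ((C * V) *ᵥ (x t - E *ᵥ xr t)) ≤
      (2 * σ (r + 1)) ^ 2 * ∫ t in (0 : ℝ)..T, u t ⬝ᵥ u t := by
  refine integral_error_le_of_truncation (S := diagSeq (r + 1) fun i => σ (i + 1))
    (S' := diagSeq (r + 1) fun i => (σ (i + 1))⁻¹) (hpos r (Nat.lt_succ_self r))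
    (diagSeq_transpose _) (diagSeq_transpose _) ?_ (diagSeq_nonneg fun i hi => (hpos i hi).le)
    (diagSeq_nonneg fun i hi => (inv_pos.2 (hpos i hi)).le) (h.reduced_ctrl hr hV hW)
    (h.reduced_obs hr hV hW) ?_ ?_ hx hxr hT hu
  · rw [diagSeq_mul_diagSeq, ← diagSeq_one]
    exact diagSeq_congr fun i hi => inv_mul_cancel₀ (hpos i hi).ne'
  · rw [hE, incl_transpose_mul_self]
  -- `1 - E Eᵀ` projects onto the single last coordinate, where the Gramian is `σ (r + 1)`; hence
  -- repeated singular values cause no difficulty.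
  · rw [hE, incl_mul_transpose, ← diagSeq_one]
    simp only [diagSeq, diagonal_sub, diagonal_mul_diagonal, ← diagonal_smul]
    congr 1
    ext i
    by_cases hi : (i : ℕ) < r
    · simp [hi]
    · have : (i : ℕ) = r := by have := i.2; lia
      simp [this]

/-- Error bound for balanced truncation on a finite time horizon. -/
theorem IsBalancingData.eLpNorm_error_le (h : IsBalancingData A B C σ P Q R L U Z)
    {u : ℝ → Fin m → ℝ} {x : ℝ → Fin n → ℝ}
    (hul : ∀ t, 0 ≤ t → IntervalIntegrable u volume 0 t) {T : ℝ} (hT : 0 ≤ T)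
    (hu : MemLp (fun t => WithLp.toLp 2 (u t)) 2 (volume.restrict (Set.Ioc 0 T)))
    (hx : IsTrajectory A B u 0 x) {r : ℕ} (hr : r ≤ n) (hpos : ∀ i, i < r → 0 < σ (i + 1))
    {V W : Matrix (Fin n) (Fin r) ℝ} (hV : V = projMatrix R Z σ hr) (hW : W = projMatrix L U σ hr)
    {xr : ℝ → Fin r → ℝ} (hxr : IsTrajectory (Wᵀ * A * V) (Wᵀ * B) u 0 xr) :
    eLpNorm (fun t => WithLp.toLp 2 (C *ᵥ (x t - V *ᵥ xr t))) 2 (volume.restrict (Set.Ioc 0 T)) ≤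
      ENNReal.ofReal (2 * ∑ i ∈ Finset.Icc (r + 1) n, σ i) *
        eLpNorm (fun t => WithLp.toLp 2 (u t)) 2 (volume.restrict (Set.Ioc 0 T)) := by
  have hiu : IntervalIntegrable (fun t => u t ⬝ᵥ u t) volume 0 T := by
    rw [intervalIntegrable_iff_integrableOn_Ioc_of_le hT]
    exact integrable_dotProduct_self hu
  obtain ⟨d, hd⟩ : ∃ d, n = r + d := Nat.exists_eq_add_of_le hr
  -- Induction on the number of discarded states. For `r = n` the convention `σ (n + 1) = 0` gives
  -- exact reproduction, even though `V` is only built from the factors.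
  induction d generalizing r with
  | zero => exact h.eLpNorm_error_le_of_eq_zero hT hu hx hr hpos (h.eq_zero _ (by lia)) hV hW hxr _
  | succ d ih =>
    rcases (h.nonneg (r + 1)).eq_or_lt with hzero | hlt
    · exact h.eLpNorm_error_le_of_eq_zero hT hu hx hr hpos hzero.symm hV hW hxr _
    have hr' : r + 1 ≤ n := by lia
    have hpos' : ∀ i, i < r + 1 → 0 < σ (i + 1) := fun i hi => by
      rcases Nat.lt_succ_iff_lt_or_eq.1 hi with hi | rfl
      · exact hpos i hi
      · exact hlt
    set V' := projMatrix R Z σ hr' with hV'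
    set W' := projMatrix L U σ hr' with hW'
    set E : Matrix (Fin (r + 1)) (Fin r) ℝ := incl (Nat.le_succ r) with hE
    have hVE : V = V' * E := hV.trans (projMatrix_eq_mul_incl R Z σ (Nat.le_succ r) hr')
    have hWE : W = W' * E := hW.trans (projMatrix_eq_mul_incl L U σ (Nat.le_succ r) hr')
    -- The model of order `r + 1` is the intermediate point of a triangle inequality: the induction
    -- hypothesis bounds one side, the removal of one state the other.
    obtain ⟨x', hx'⟩ := exists_isTrajectory (W'ᵀ * A * V') (W'ᵀ * B) hul
    have h1 := ih hr' hpos' hV' hW' hx' (by lia)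
    have hxr' : IsTrajectory (Eᵀ * (W'ᵀ * A * V') * E) (Eᵀ * (W'ᵀ * B)) u 0 xr := by
      convert hxr using 1
      · rw [hVE, hWE, transpose_mul]; simp only [Matrix.mul_assoc]
      · rw [hWE, transpose_mul, Matrix.mul_assoc]
    have h2 := h.integral_error_succ_le hT hiu hr' hpos' hV' hW' hE hx' hxr'
    rw [intervalIntegral.integral_of_le hT, intervalIntegral.integral_of_le hT] at h2
    have m1 := memLp_toLp_of_continuousOn (continuousOn_mulVec C
      ((hx.continuousOn_Icc T).sub (continuousOn_mulVec V' (hx'.continuousOn_Icc T))))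
    have m2 := memLp_toLp_of_continuousOn (continuousOn_mulVec (C * V')
      ((hx'.continuousOn_Icc T).sub (continuousOn_mulVec E (hxr.continuousOn_Icc T))))
    have h3 := eLpNorm_toLp_le_of_integral_le m2 hu (by linarith) h2
    have hsplit : (fun t => WithLp.toLp 2 (C *ᵥ (x t - V *ᵥ xr t))) =
        (fun t => WithLp.toLp 2 (C *ᵥ (x t - V' *ᵥ x' t))) +
          fun t => WithLp.toLp 2 ((C * V') *ᵥ (x' t - E *ᵥ xr t)) := by
      ext1 t
      rw [Pi.add_apply, ← WithLp.toLp_add, hVE]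
      congr 1
      simp only [mulVec_sub, mulVec_mulVec, Matrix.mul_assoc]
      abel
    have hsum : ∑ i ∈ Finset.Icc (r + 1) n, σ i =
        ∑ i ∈ Finset.Icc (r + 1 + 1) n, σ i + σ (r + 1) := by
      rw [← Finset.insert_Icc_add_one_left_eq_Icc hr', Finset.sum_insert (by simp), add_comm]
    rw [hsplit, hsum, mul_add, ENNReal.ofReal_add
      (mul_nonneg zero_le_two (Finset.sum_nonneg fun i _ => h.nonneg i)) (by linarith), add_mul]
    exact (eLpNorm_add_le m1.1 m2.1 (by norm_num)).trans (add_le_add h1 h3)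

end

/-! ### Stability of the truncated model. -/

section

variable {ι κ ρ η : Type*} [Fintype ι] [Fintype κ] [Fintype ρ] [Fintype η]

theorem star_dotProduct_mulVec_conjTranspose (M : Matrix ι κ ℂ) (v : κ → ℂ) (w : ι → ℂ) :
    star v ⬝ᵥ Mᴴ *ᵥ w = star (M *ᵥ v) ⬝ᵥ w := by
  rw [star_mulVec, dotProduct_mulVec]

theorem star_dotProduct_diagonal_mulVec [DecidableEq ρ] (d : ρ → ℝ) (w : ρ → ℂ) :
    star w ⬝ᵥ (diagonal fun i => (d i : ℂ)) *ᵥ w = ((∑ i, d i * ‖w i‖ ^ 2 : ℝ) : ℂ) := by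
  simp only [dotProduct, mulVec_diagonal, Pi.star_apply, RCLike.star_def, Complex.ofReal_sum,
    Complex.ofReal_mul, Complex.ofReal_pow]
  refine Finset.sum_congr rfl fun i _ => ?_
  rw [← Complex.conj_mul']
  ring

/-- Eigenvectors of a matrix with positive definite observability Gramian to eigenvalues in the
closed right half-plane are unobservable, and the eigenvalue is imaginary. -/
theorem unobservable_of_lyapunov [DecidableEq ρ] {A : Matrix ρ ρ ℂ} {C : Matrix η ρ ℂ} {d : ρ → ℝ}
    (hd : ∀ i, 0 < d i)
    (ho : Aᴴ * (diagonal fun i => (d i : ℂ)) + (diagonal fun i => (d i : ℂ)) * A + Cᴴ * C = 0)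
    {μ : ℂ} (hμ : 0 ≤ μ.re) {w : ρ → ℂ} (hw : A *ᵥ w = μ • w) :
    C *ᵥ w = 0 ∧ (w ≠ 0 → μ.re = 0) := by
  have h1 : star w ⬝ᵥ (Aᴴ * (diagonal fun i => (d i : ℂ)) + (diagonal fun i => (d i : ℂ)) * A +
      Cᴴ * C) *ᵥ w = 0 := by rw [ho]; simp
  rw [add_mulVec, add_mulVec, dotProduct_add, dotProduct_add, ← mulVec_mulVec, ← mulVec_mulVec,
    ← mulVec_mulVec, star_dotProduct_mulVec_conjTranspose, star_dotProduct_mulVec_conjTranspose,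
    hw, mulVec_smul, dotProduct_smul, star_smul, smul_dotProduct,
    star_dotProduct_diagonal_mulVec] at h1
  set N := ∑ i, d i * ‖w i‖ ^ 2 with hN
  have hN0 : 0 ≤ N := Finset.sum_nonneg fun i _ => mul_nonneg (hd i).le (sq_nonneg _)
  have hC : star (C *ᵥ w) ⬝ᵥ (C *ᵥ w) = ((∑ i, ‖(C *ᵥ w) i‖ ^ 2 : ℝ) : ℂ) := by
    simp only [dotProduct, Pi.star_apply, RCLike.star_def, Complex.ofReal_sum, Complex.ofReal_pow,
      Complex.conj_mul']
  rw [hC] at h1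
  -- Real part of the Lyapunov equation paired with `w`; both summands are nonnegative and therefore
  -- vanish.
  have h2 : 2 * μ.re * N + ∑ i, ‖(C *ᵥ w) i‖ ^ 2 = 0 := by
    have := congrArg Complex.re h1
    simp only [RCLike.star_def, smul_eq_mul, Complex.add_re, Complex.mul_re, Complex.conj_re,
      Complex.ofReal_re, Complex.conj_im, Complex.ofReal_im, mul_zero, sub_zero,
      Complex.zero_re] at this
    linarith
  have h3 : 0 ≤ ∑ i, ‖(C *ᵥ w) i‖ ^ 2 := Finset.sum_nonneg fun i _ => sq_nonneg _
  have h4 : 0 ≤ 2 * μ.re * N := by positivity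
  constructor
  · have h5 : ∑ i, ‖(C *ᵥ w) i‖ ^ 2 = 0 := by linarith
    rw [Finset.sum_eq_zero_iff_of_nonneg fun i _ => sq_nonneg _] at h5
    ext i
    simpa using h5 i (Finset.mem_univ i)
  · intro hne
    obtain ⟨i, hi⟩ := Function.ne_iff.1 hne
    have hNpos : 0 < N := by
      refine Finset.sum_pos' (fun i _ => mul_nonneg (hd i).le (sq_nonneg _))
        ⟨i, Finset.mem_univ i, mul_pos (hd i) ?_⟩
      have : 0 < ‖w i‖ := norm_pos_iff.2 hi
      positivity
    have h5 : μ.re * N = 0 := by linarith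
    exact (mul_eq_zero.1 h5).resolve_right hNpos.ne'

open scoped ComplexOrder in
/-- For a balanced matrix, the eigenspaces to eigenvalues in the closed right half-plane are
uncontrollable, unobservable and invariant under the squared Gramian. -/
theorem eigenspace_invariant_of_balanced [DecidableEq ρ] {A : Matrix ρ ρ ℂ} {B : Matrix ρ κ ℂ}
    {C : Matrix η ρ ℂ} {d : ρ → ℝ} (hd : ∀ i, 0 < d i) {S : Matrix ρ ρ ℂ}
    (hS : S = diagonal fun i => (d i : ℂ))
    (hc : A * S + S * Aᴴ + B * Bᴴ = 0) (ho : Aᴴ * S + S * A + Cᴴ * C = 0)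
    {μ : ℂ} (hμ : 0 ≤ μ.re) {w : ρ → ℂ} (hw : A *ᵥ w = μ • w) :
    C *ᵥ w = 0 ∧ Bᴴ *ᵥ S *ᵥ w = 0 ∧ A *ᵥ S *ᵥ S *ᵥ w = μ • S *ᵥ S *ᵥ w := by
  by_cases hw0 : w = 0
  · subst hw0; simp
  obtain ⟨hC, hre⟩ := unobservable_of_lyapunov hd (hS ▸ ho) hμ hw
  have hre := hre hw0
  have h1 : Aᴴ *ᵥ S *ᵥ w = -(μ • S *ᵥ w) := by
    have := congrArg (· *ᵥ w) ho
    simp only [add_mulVec, ← mulVec_mulVec, hC, hw, mulVec_zero, zero_mulVec, add_zero,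
      mulVec_smul] at this
    exact eq_neg_of_add_eq_zero_left this
  have h2 : A *ᵥ S *ᵥ S *ᵥ w - μ • S *ᵥ S *ᵥ w + B *ᵥ Bᴴ *ᵥ S *ᵥ w = 0 := by
    have := congrArg (· *ᵥ S *ᵥ w) hc
    simp only [add_mulVec, ← mulVec_mulVec, zero_mulVec, h1, mulVec_neg, mulVec_smul] at this
    rw [sub_eq_add_neg]
    exact this
  -- `S w` is an eigenvector of `Aᴴ` for `-μ`, and `-conj μ = μ` because `μ` is imaginary. Pairing
  -- `h2` with `S w` then leaves only `|Bᴴ S w|²`.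
  have hA : star (S *ᵥ w) ⬝ᵥ A *ᵥ S *ᵥ S *ᵥ w = μ * (star (S *ᵥ w) ⬝ᵥ S *ᵥ S *ᵥ w) := by
    have := star_dotProduct_mulVec_conjTranspose Aᴴ (S *ᵥ w) (S *ᵥ S *ᵥ w)
    rw [conjTranspose_conjTranspose] at this
    rw [this, h1, star_neg, star_smul, neg_dotProduct, smul_dotProduct, smul_eq_mul,
      ← neg_mul]
    congr 1
    apply Complex.ext <;> simp [hre]
  have h3 : star (Bᴴ *ᵥ S *ᵥ w) ⬝ᵥ (Bᴴ *ᵥ S *ᵥ w) = 0 := by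
    have := congrArg (star (S *ᵥ w) ⬝ᵥ ·) h2
    simp only [dotProduct_add, dotProduct_sub, dotProduct_smul, hA, dotProduct_zero, smul_eq_mul,
      sub_self, zero_add] at this
    rw [← star_dotProduct_mulVec_conjTranspose, conjTranspose_conjTranspose]
    exact this
  have hB : Bᴴ *ᵥ S *ᵥ w = 0 := dotProduct_star_self_eq_zero.1 h3
  refine ⟨hC, hB, ?_⟩
  rw [hB, mulVec_zero, add_zero, sub_eq_zero] at h2
  exact h2

/-- An eigenvalue in the closed right half-plane of a balanced truncation is an eigenvalue of the
full matrix, provided that the Hankel singular values are separated. -/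
theorem exists_eigenvector_of_truncation [DecidableEq ρ] {A P Q : Matrix ι ι ℂ} {B : Matrix ι κ ℂ}
    {C : Matrix η ι ℂ} {V W : Matrix ι ρ ℂ} {d : ρ → ℝ} (hd : ∀ i, 0 < d i) {S : Matrix ρ ρ ℂ}
    (hS : S = diagonal fun i => (d i : ℂ))
    (hP : A * P + P * Aᴴ + B * Bᴴ = 0) (hQ : Aᴴ * Q + Q * A + Cᴴ * C = 0)
    (hQV : Q * V = W * S) (hPW : P * W = V * S) (hWV : Wᴴ * V = 1)
    (hc : (Wᴴ * A * V) * S + S * (Wᴴ * A * V)ᴴ + (Wᴴ * B) * (Wᴴ * B)ᴴ = 0)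
    (ho : (Wᴴ * A * V)ᴴ * S + S * (Wᴴ * A * V) + (C * V)ᴴ * (C * V) = 0)
    (hsep : ∀ i b, P *ᵥ Q *ᵥ b = ((d i : ℂ) ^ 2) • b → Wᴴ *ᵥ b = 0 → b = 0)
    {μ : ℂ} (hμ : 0 ≤ μ.re) {v : ρ → ℂ} (hv : v ≠ 0) (hev : (Wᴴ * A * V) *ᵥ v = μ • v) :
    ∃ a : ι → ℂ, a ≠ 0 ∧ A *ᵥ a = μ • a := by
  set F : Submodule ℂ (ρ → ℂ) := Module.End.eigenspace (Matrix.toLin' (Wᴴ * A * V)) μ with hF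
  have hmem : ∀ w, w ∈ F ↔ (Wᴴ * A * V) *ᵥ w = μ • w := fun w => by
    rw [hF, Module.End.mem_eigenspace_iff, Matrix.toLin'_apply]
  have hinv : ∀ w ∈ F, (Matrix.toLin' (S * S)) w ∈ F := fun w hw => by
    rw [hmem] at hw ⊢
    rw [Matrix.toLin'_apply, ← mulVec_mulVec w S S]
    exact (eigenspace_invariant_of_balanced hd hS hc ho hμ hw).2.2
  have : Nontrivial F := ⟨⟨⟨v, (hmem v).2 hev⟩, 0, fun h => hv (congrArg Subtype.val h)⟩⟩
  -- The eigenspace is invariant under `S²`, so it contains a common eigenvector; as `S` is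
  -- diagonal, `lam` is some `d i ^ 2`.
  obtain ⟨lam, hlam⟩ := Module.End.exists_eigenvalue ((Matrix.toLin' (S * S)).restrict hinv)
  obtain ⟨⟨w, hwF⟩, hw⟩ := hlam.exists_hasEigenvector
  have hw0 : w ≠ 0 := fun h => hw.2 (Subtype.ext h)
  have hwS : S *ᵥ S *ᵥ w = lam • w := by
    have := congrArg Subtype.val hw.apply_eq_smul
    simpa [LinearMap.restrict_apply, mulVec_mulVec] using this
  have hwA := (hmem w).1 hwF
  obtain ⟨hC, hB, -⟩ := eigenspace_invariant_of_balanced hd hS hc ho hμ hwA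
  obtain ⟨i, hi⟩ := Function.ne_iff.1 hw0
  have hl : lam = (d i : ℂ) ^ 2 := by
    have := congrFun hwS i
    rw [hS] at this
    simp only [mulVec_diagonal, Pi.smul_apply, smul_eq_mul, ← mul_assoc] at this
    rw [sq]
    exact (mul_right_cancel₀ hi this).symm
  have h1 : Aᴴ *ᵥ W *ᵥ S *ᵥ w = -(Q *ᵥ A *ᵥ V *ᵥ w) := by
    have := congrArg (· *ᵥ V *ᵥ w) hQ
    simp only [add_mulVec, ← mulVec_mulVec, zero_mulVec] at this
    rw [mulVec_mulVec w Q V, hQV, mulVec_mulVec w C V, hC, mulVec_zero, add_zero,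
      ← mulVec_mulVec] at this
    exact eq_neg_of_add_eq_zero_left this
  have hPQV : ∀ a, P *ᵥ Q *ᵥ V *ᵥ a = V *ᵥ S *ᵥ S *ᵥ a := fun a => by
    rw [mulVec_mulVec a Q V, hQV, ← mulVec_mulVec, mulVec_mulVec _ P W, hPW, ← mulVec_mulVec]
  have h2 : P *ᵥ Q *ᵥ A *ᵥ V *ᵥ w = lam • A *ᵥ V *ᵥ w := by
    have := congrArg (· *ᵥ W *ᵥ S *ᵥ w) hP
    simp only [add_mulVec, ← mulVec_mulVec, zero_mulVec, h1, mulVec_neg] at this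
    rw [conjTranspose_mul, conjTranspose_conjTranspose, ← mulVec_mulVec] at hB
    rw [hB, mulVec_zero, add_zero, mulVec_mulVec _ P W, hPW, ← mulVec_mulVec, hwS, mulVec_smul,
      mulVec_smul, ← sub_eq_add_neg, sub_eq_zero] at this
    exact this.symm
  -- Both terms are fixed by `P Q` up to the factor `lam`, and `Wᴴ V = 1` makes `Wᴴ` kill their
  -- difference; separation applies.
  have hb : A *ᵥ V *ᵥ w - V *ᵥ (Wᴴ * A * V) *ᵥ w = 0 := by
    refine hsep i _ ?_ ?_
    · rw [mulVec_sub, mulVec_sub, h2, hPQV, hwA, mulVec_smul, mulVec_smul, hwS, ← hl, smul_sub,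
        mulVec_smul, mulVec_smul, mulVec_smul, smul_comm]
    · rw [mulVec_sub, mulVec_mulVec _ Wᴴ V, hWV, one_mulVec, sub_eq_zero]
      simp only [mulVec_mulVec, Matrix.mul_assoc]
  refine ⟨V *ᵥ w, fun h => hw0 ?_, ?_⟩
  · rw [← one_mulVec w, ← hWV, ← mulVec_mulVec, h, mulVec_zero]
  · rw [sub_eq_zero.1 hb, hwA, mulVec_smul]

end

/-! ### Transfer to real matrices. -/

/-- Complexification of a real matrix. -/
abbrev cx {ι κ : Type*} (M : Matrix ι κ ℝ) : Matrix ι κ ℂ := M.map fun a : ℝ => (a : ℂ)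

section

variable {ι κ ρ : Type*}

theorem cx_mul [Fintype κ] (M : Matrix ι κ ℝ) (N : Matrix κ ρ ℝ) : cx (M * N) = cx M * cx N :=
  Matrix.map_mul (f := Complex.ofRealHom)

theorem cx_add (M N : Matrix ι κ ℝ) : cx (M + N) = cx M + cx N := by
  ext; simp

theorem cx_zero : cx (0 : Matrix ι κ ℝ) = 0 := by
  ext; simp

theorem cx_one [DecidableEq ι] : cx (1 : Matrix ι ι ℝ) = 1 := by
  ext i j; simp [Matrix.one_apply, apply_ite]

theorem cx_transpose (M : Matrix ι κ ℝ) : cx Mᵀ = (cx M)ᴴ := by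
  ext; simp

theorem cx_diagSeq {r : ℕ} (f : ℕ → ℝ) :
    cx (diagSeq r f) = diagonal fun i : Fin r => (f i : ℂ) := by
  rw [cx, diagSeq, Matrix.diagonal_map (by simp)]

theorem mem_spectrum_cx_iff [Fintype ι] [DecidableEq ι] (A : Matrix ι ι ℝ) (μ : ℂ) :
    μ ∈ spectrum ℂ (A.map fun a : ℝ => (a : ℂ)) ↔ ∃ v : ι → ℂ, v ≠ 0 ∧ cx A *ᵥ v = μ • v := by
  rw [← Matrix.spectrum_toLin', ← Module.End.hasEigenvalue_iff_mem_spectrum]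
  constructor
  · intro h
    obtain ⟨v, hv⟩ := h.exists_hasEigenvector
    exact ⟨v, hv.2, by simpa using hv.apply_eq_smul⟩
  · rintro ⟨v, hv, h⟩
    exact Module.End.hasEigenvalue_of_hasEigenvector
      (Module.End.hasEigenvector_iff.2 ⟨Module.End.mem_eigenspace_iff.2 (by simpa using h), hv⟩)

end

section

variable {n m p : ℕ} {A : Matrix (Fin n) (Fin n) ℝ} {B : Matrix (Fin n) (Fin m) ℝ}
  {C : Matrix (Fin p) (Fin n) ℝ} {σ : ℕ → ℝ} {P Q R L U Z : Matrix (Fin n) (Fin n) ℝ}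

/-- In the coordinates `c = Uᵀ Lᵀ b` the product `P Q` becomes `Σ²`. The leading `r` entries of `c`
vanish because `Wᴴ b = 0`, the others because the gap keeps their squared singular values away from
the eigenvalue; that eigenvalue is nonzero, so `b` is recovered from `c`. -/
theorem IsBalancingData.eq_zero_of_separated (h : IsBalancingData A B C σ P Q R L U Z) {r : ℕ}
    (hr : r ≤ n) (hpos : ∀ i, i < r → 0 < σ (i + 1)) (hgap : ∀ i, i < r → σ (r + 1) < σ (i + 1))
    {W : Matrix (Fin n) (Fin r) ℝ} (hW : W = projMatrix L U σ hr) (i : Fin r) (b : Fin n → ℂ)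
    (hb : cx P *ᵥ cx Q *ᵥ b = ((σ (i + 1) : ℂ) ^ 2) • b) (hWb : (cx W)ᴴ *ᵥ b = 0) : b = 0 := by
  have hne : ((σ (i + 1) : ℂ) ^ 2) ≠ 0 := by
    have := (hpos i i.2).ne'
    exact pow_ne_zero 2 (by exact_mod_cast this)
  set c : Fin n → ℂ := cx (Uᵀ * Lᵀ) *ᵥ b with hc
  set S := diagSeq n fun i => σ (i + 1) with hS
  have h1 : cx P *ᵥ cx Q *ᵥ b = cx (R * Z) *ᵥ cx S *ᵥ c := by
    rw [hc, mulVec_mulVec, mulVec_mulVec, mulVec_mulVec, ← cx_mul, ← cx_mul, ← cx_mul]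
    congr 2
    rw [h.eqP, h.eqQ]
    calc R * Rᵀ * (L * Lᵀ) = R * (Rᵀ * L) * Lᵀ := by simp only [Matrix.mul_assoc]
      _ = _ := by rw [h.svd']; simp only [Matrix.mul_assoc, hS]
  rw [h1] at hb
  have h2 : cx S *ᵥ cx S *ᵥ c = ((σ (i + 1) : ℂ) ^ 2) • c := by
    have := congrArg (cx (Uᵀ * Lᵀ) *ᵥ ·) hb
    simp only [mulVec_smul] at this
    rw [← hc] at this
    rw [← this, mulVec_mulVec _ (cx (Uᵀ * Lᵀ)), ← cx_mul]
    congr 2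
    calc S = (Uᵀ * U) * S * (Zᵀ * Z) := by rw [h.orthU, h.orthZ, Matrix.one_mul, Matrix.mul_one]
      _ = Uᵀ * (U * S * Zᵀ) * Z := by simp only [Matrix.mul_assoc]
      _ = _ := by rw [← h.svd]; simp only [Matrix.mul_assoc]
  have hc0 : c = 0 := by
    ext j
    by_cases hj : (j : ℕ) < r
    · have h3 : (cx W)ᴴ *ᵥ b =
          cx ((diagSeq r fun i => (Real.sqrt (σ (i + 1)))⁻¹) * (incl hr)ᵀ) *ᵥ c := by
        rw [hc, mulVec_mulVec, ← cx_mul, ← cx_transpose, hW, projMatrix]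
        congr 2
        simp only [transpose_mul, diagSeq_transpose, Matrix.mul_assoc]
      rw [h3, cx_mul, ← mulVec_mulVec, cx_diagSeq] at hWb
      have h4 := congrFun hWb ⟨j, hj⟩
      simp only [mulVec_diagonal, Pi.zero_apply] at h4
      have h5 : (cx (incl hr)ᵀ *ᵥ c) ⟨j, hj⟩ = c j := by
        rw [mulVec, dotProduct, Finset.sum_eq_single j]
        · simp [incl_apply]
        · intro l _ hl
          have : (l : ℕ) ≠ j := fun h => hl (Fin.ext h)
          simp [incl_apply, this]
        · simp
      rw [h5] at h4
      have h6 := (inv_pos.2 (Real.sqrt_pos.2 (hpos j hj))).ne'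
      exact (mul_eq_zero.1 h4).resolve_left (by exact_mod_cast h6)
    · have h3 := congrFun h2 j
      rw [hS, cx_diagSeq] at h3
      simp only [mulVec_diagonal, Pi.smul_apply, smul_eq_mul] at h3
      have h4 : σ (j + 1) < σ (i + 1) :=
        (h.antitone (r + 1) (j + 1) (by lia) (by lia)).trans_lt (hgap i i.2)
      have h5 : σ (j + 1) ^ 2 - σ (i + 1) ^ 2 ≠ 0 := by
        have := h.nonneg (j + 1)
        nlinarith
      have h6 : ((σ (j + 1) ^ 2 - σ (i + 1) ^ 2 : ℝ) : ℂ) * c j = 0 := by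
        push_cast
        rw [sub_mul, ← h3]; ring
      exact (mul_eq_zero.1 h6).resolve_left (by exact_mod_cast h5)
  rw [hc0, mulVec_zero, mulVec_zero] at hb
  exact (smul_eq_zero.1 hb.symm).resolve_left hne

/-- Balanced truncation preserves asymptotic stability. -/
theorem IsBalancingData.isAsymptoticallyStable (h : IsBalancingData A B C σ P Q R L U Z)
    (hA : IsAsymptoticallyStable A) {r : ℕ}
    (hr : r ≤ n) (hpos : ∀ i, i < r → 0 < σ (i + 1)) (hgap : ∀ i, i < r → σ (r + 1) < σ (i + 1))
    {V W : Matrix (Fin n) (Fin r) ℝ} (hV : V = projMatrix R Z σ hr)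
    (hW : W = projMatrix L U σ hr) : IsAsymptoticallyStable (Wᵀ * A * V) := by
  intro μ hμ
  obtain ⟨v, hv, hev⟩ := (mem_spectrum_cx_iff _ μ).1 hμ
  by_contra hre
  obtain ⟨a, ha, hAa⟩ := exists_eigenvector_of_truncation (A := cx A) (P := cx P) (Q := cx Q)
    (B := cx B) (C := cx C) (V := cx V) (W := cx W) (fun i : Fin r => hpos i i.2)
    (cx_diagSeq fun i => σ (i + 1))
    (by simpa only [cx_add, cx_mul, cx_transpose, cx_zero] using congrArg cx h.ctrl)
    (by simpa only [cx_add, cx_mul, cx_transpose, cx_zero] using congrArg cx h.obs)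
    (by rw [← cx_mul, ← cx_mul, hV, hW, h.Q_mul_V])
    (by rw [← cx_mul, ← cx_mul, hV, hW, h.P_mul_W])
    (by rw [← cx_transpose, ← cx_mul, hV, hW, h.W_mul_V hr hpos, cx_one])
    (by simpa only [cx_add, cx_mul, cx_transpose, cx_zero] using
      congrArg cx (h.reduced_ctrl hr hV hW))
    (by simpa only [cx_add, cx_mul, cx_transpose, cx_zero] using
      congrArg cx (h.reduced_obs hr hV hW))
    (h.eq_zero_of_separated hr hpos hgap hW) (not_lt.1 hre) hv
    (by simpa only [cx_mul, cx_transpose] using hev)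
  exact hre (hA μ ((mem_spectrum_cx_iff A μ).2 ⟨a, ha, hAa⟩))

end

/-! ### Shifting the initial value into an input. -/

section

variable {ι κ ρ τ : Type*} [Fintype ι] [Fintype κ] [Fintype ρ] [Fintype τ]

/-- Linear images of trajectories under intertwining matrices are trajectories. -/
theorem IsTrajectory.map {A : Matrix ι ι ℝ} {B : Matrix ι κ ℝ} {u : ℝ → κ → ℝ} {x₀ : ι → ℝ}
    {x : ℝ → ι → ℝ} (h : IsTrajectory A B u x₀ x) {A' : Matrix ρ ρ ℝ} {B' : Matrix ρ κ ℝ}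
    (M : Matrix ρ ι ℝ) (hA : M * A = A' * M) (hB : M * B = B') :
    IsTrajectory A' B' u (M *ᵥ x₀) fun t => M *ᵥ x t := by
  have he : (fun s => A' *ᵥ M *ᵥ x s + B' *ᵥ u s) = fun s => M *ᵥ (A *ᵥ x s + B *ᵥ u s) := by
    ext1 s
    rw [mulVec_add, mulVec_mulVec, mulVec_mulVec, mulVec_mulVec, hA, hB]
  refine ⟨continuousOn_mulVec M h.continuousOn, fun t ht => ?_, fun t ht => ?_⟩
  · rw [he]
    exact intervalIntegrable_mulVec M (h.intervalIntegrable t ht)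
  · rw [he, intervalIntegral_mulVec M (h.intervalIntegrable t ht), ← mulVec_add,
      ← h.eq_integral t ht]

/-- The free response to `x₀`, minus `e^{-αt} x₀`, is the response from the zero state to the
exponentially decaying input `e^{-αt} (A + α I) x₀`. -/
theorem IsTrajectory.sub_sub_exp [DecidableEq ι] {A : Matrix ι ι ℝ} {B : Matrix ι κ ℝ}
    {B' : Matrix ι τ ℝ} {u : ℝ → κ → ℝ} {v : ℝ → τ → ℝ} {x₀ : ι → ℝ} {x ζ : ℝ → ι → ℝ} {α : ℝ}
    (hx : IsTrajectory A B u x₀ x) (hζ : IsTrajectory A B u 0 ζ)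
    (hv : ∀ t, B' *ᵥ v t = Real.exp (-α * t) • ((A + α • (1 : Matrix ι ι ℝ)) *ᵥ x₀)) :
    IsTrajectory A B' v 0 fun t => x t - ζ t - Real.exp (-α * t) • x₀ := by
  have he : (fun s => A *ᵥ (x s - ζ s - Real.exp (-α * s) • x₀) + B' *ᵥ v s) =
      fun s => (A *ᵥ x s + B *ᵥ u s) - (A *ᵥ ζ s + B *ᵥ u s) +
        (α * Real.exp (-α * s)) • x₀ := by
    ext1 s
    rw [hv, mulVec_sub, mulVec_sub, mulVec_smul, add_mulVec, smul_mulVec, one_mulVec, smul_add,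
      smul_smul, mul_comm α]
    abel
  have hcont : Continuous fun s : ℝ => (α * Real.exp (-α * s)) • x₀ := by fun_prop
  have hexp : ∀ t : ℝ, ∫ s in (0 : ℝ)..t, (α * Real.exp (-α * s)) • x₀ =
      x₀ - Real.exp (-α * t) • x₀ := by
    intro t
    have hd : ∀ s : ℝ, HasDerivAt (fun s => -(Real.exp (-α * s) • x₀))
        ((α * Real.exp (-α * s)) • x₀) s := by
      intro s
      have h1 : HasDerivAt (fun s : ℝ => -α * s) (-α) s := by
        simpa using (hasDerivAt_id s).const_mul (-α)
      convert! (h1.exp.smul_const x₀).neg using 1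
      rw [← neg_smul]
      congr 1
      ring
    rw [intervalIntegral.integral_eq_sub_of_hasDerivAt (fun s _ => hd s)
      (hcont.intervalIntegrable _ _)]
    simp only [mul_zero, Real.exp_zero, one_smul]
    abel
  refine ⟨(hx.continuousOn.sub hζ.continuousOn).sub (by fun_prop), fun t ht => ?_, fun t ht => ?_⟩
  · rw [he]
    exact ((hx.intervalIntegrable t ht).sub (hζ.intervalIntegrable t ht)).add
      (hcont.intervalIntegrable _ _)
  · rw [he, intervalIntegral.integral_add
      ((hx.intervalIntegrable t ht).sub (hζ.intervalIntegrable t ht))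
      (hcont.intervalIntegrable _ _), intervalIntegral.integral_sub (hx.intervalIntegrable t ht)
      (hζ.intervalIntegrable t ht), hexp, hx.eq_integral t ht, hζ.eq_integral t ht]
    abel

theorem isTrajectory_zero {A : Matrix ι ι ℝ} {u : ℝ → κ → ℝ} :
    IsTrajectory A (0 : Matrix ι κ ℝ) u 0 fun _ => 0 := by
  refine ⟨continuousOn_const, fun t _ => ?_, fun t _ => ?_⟩ <;> simp

theorem MemL2.memLp_Ioc {g : ℝ → κ → ℝ} (hg : MemL2 g) (T : ℝ) :
    MemLp (fun t => WithLp.toLp 2 (g t)) 2 (volume.restrict (Set.Ioc 0 T)) :=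
  MemLp.mono_measure (Measure.restrict_mono (fun _ ht => ht.1.le) le_rfl) hg

theorem MemL2.intervalIntegrable {g : ℝ → κ → ℝ} (hg : MemL2 g) (T : ℝ) (hT : 0 ≤ T) :
    IntervalIntegrable g volume 0 T := by
  rw [intervalIntegrable_iff_integrableOn_Ioc_of_le hT]
  have h := (hg.memLp_Ioc T).integrable (by norm_num)
  exact (PiLp.continuousLinearEquiv 2 ℝ fun _ : κ => ℝ).toContinuousLinearMap.integrable_comp h

theorem MemL2.eLpNorm_eq {g : ℝ → κ → ℝ} (hg : MemL2 g) :
    eLpNorm (fun t => WithLp.toLp 2 (g t)) 2 (volume.restrict (Set.Ici 0)) =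
      ENNReal.ofReal (normL2 g) :=
  eLpNorm_toLp_eq hg

/-- Uniform bounds on finite horizons bound the norm on `[0, ∞)`. -/
theorem eLpNorm_Ici_le_of_forall_Ioc {E : Type*} [NormedAddCommGroup E] {g : ℝ → E} {K : ENNReal}
    (h : ∀ T, 0 ≤ T → eLpNorm g 2 (volume.restrict (Set.Ioc 0 T)) ≤ K) :
    eLpNorm g 2 (volume.restrict (Set.Ici 0)) ≤ K := by
  have hU : (⋃ N : ℕ, Set.Ioc (0 : ℝ) N) = Set.Ioi 0 := by
    ext t
    simp only [Set.mem_iUnion, Set.mem_Ioc, Set.mem_Ioi]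
    exact ⟨fun ⟨_, h⟩ => h.1, fun h => (exists_nat_ge t).imp fun _ hN => ⟨h, hN⟩⟩
  have hmono : Monotone fun N : ℕ => Set.Ioc (0 : ℝ) N := fun a b hab =>
    Set.Ioc_subset_Ioc_right (by exact_mod_cast hab)
  have hk : ∀ s : Set ℝ, eLpNorm g 2 (volume.restrict s) ≤ K ↔
      ∫⁻ t in s, ‖g t‖ₑ ^ (2 : ℝ) ≤ K ^ (2 : ℝ) := fun s => by
    rw [eLpNorm_eq_lintegral_rpow_enorm_toReal (by simp) (by simp), one_div]
    exact ENNReal.rpow_inv_le_iff (by simp)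
  -- Monotone convergence along the horizons `(0, N]`.
  rw [← restrict_Ioi_eq_restrict_Ici, hk, ← hU,
    setLIntegral_iUnion_of_directed _ hmono.directed_le]
  exact iSup_le fun N => (hk _).1 (h N N.cast_nonneg)

/-- The exponentially decaying input `√(2α) e^{-αt} z` has `𝕃₂`-norm at most `‖z‖`. -/
theorem eLpNorm_exp_input_le {α : ℝ} (hα : 0 < α) (z : κ → ℝ) {T : ℝ} (hT : 0 ≤ T) :
    eLpNorm (fun t => WithLp.toLp 2 ((Real.sqrt (2 * α) * Real.exp (-α * t)) • z)) 2
      (volume.restrict (Set.Ioc 0 T)) ≤ ENNReal.ofReal ‖WithLp.toLp 2 z‖ := by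
  have hc : Continuous fun t : ℝ => (Real.sqrt (2 * α) * Real.exp (-α * t)) • z := by fun_prop
  rw [eLpNorm_toLp_eq (memLp_toLp_of_continuousOn hc.continuousOn)]
  apply ENNReal.ofReal_le_ofReal
  refine Real.sqrt_le_iff.2 ⟨norm_nonneg _, ?_⟩
  rw [norm_toLp_sq, ← intervalIntegral.integral_of_le hT]
  have he : ∀ t : ℝ, ((Real.sqrt (2 * α) * Real.exp (-α * t)) • z) ⬝ᵥ
      ((Real.sqrt (2 * α) * Real.exp (-α * t)) • z) =
      2 * α * Real.exp (-(2 * α) * t) * (z ⬝ᵥ z) := by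
    intro t
    have h1 : Real.exp (-(2 * α) * t) = Real.exp (-α * t) * Real.exp (-α * t) := by
      rw [← Real.exp_add]; ring_nf
    have h2 := Real.mul_self_sqrt (show 0 ≤ 2 * α by linarith)
    rw [smul_dotProduct, dotProduct_smul, smul_eq_mul, smul_eq_mul, h1]
    linear_combination (Real.exp (-α * t) * Real.exp (-α * t) * (z ⬝ᵥ z)) * h2
  have hd : ∀ s : ℝ, HasDerivAt (fun s => -(Real.exp (-(2 * α) * s)) * (z ⬝ᵥ z))
      (2 * α * Real.exp (-(2 * α) * s) * (z ⬝ᵥ z)) s := by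
    intro s
    have h1 : HasDerivAt (fun s : ℝ => -(2 * α) * s) (-(2 * α)) s := by
      simpa using (hasDerivAt_id s).const_mul (-(2 * α))
    convert! (h1.exp.neg.mul_const (z ⬝ᵥ z)) using 1
    ring
  simp only [he]
  rw [intervalIntegral.integral_eq_sub_of_hasDerivAt (fun s _ => hd s)
    (Continuous.intervalIntegrable (by fun_prop) _ _)]
  have h1 := dotProduct_self_nonneg' z
  have h2 := Real.exp_pos (-(2 * α) * T)
  simp only [mul_zero, Real.exp_zero]
  -- The integral equals `(1 - e^{-2αT}) |z|²`.
  nlinarith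

end

theorem isUnit_det_add_smul_one {ι : Type*} [Fintype ι] [DecidableEq ι] {A : Matrix ι ι ℝ} {α : ℝ}
    (h : ¬ Module.End.HasEigenvalue (Matrix.toLin' A) (-α)) :
    IsUnit (A + α • (1 : Matrix ι ι ℝ)).det := by
  rw [isUnit_iff_ne_zero]
  intro hdet
  obtain ⟨v, hv, hv0⟩ := Matrix.exists_mulVec_eq_zero_iff.2 hdet
  refine h (Module.End.hasEigenvalue_of_hasEigenvector (x := v)
    (Module.End.hasEigenvector_iff.2 ⟨Module.End.mem_eigenspace_iff.2 ?_, hv⟩))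
  rw [add_mulVec, smul_mulVec, one_mulVec] at hv0
  rw [Matrix.toLin'_apply, neg_smul]
  exact eq_neg_of_add_eq_zero_left hv0

theorem isAsymptoticallyStable_fromBlocks {ι κ : Type*} [Fintype ι] [Fintype κ] [DecidableEq ι]
    [DecidableEq κ] {A : Matrix ι ι ℝ} {D : Matrix κ κ ℝ} (hA : IsAsymptoticallyStable A)
    (hD : IsAsymptoticallyStable D) : IsAsymptoticallyStable (fromBlocks A 0 0 D) := by
  intro μ hμ
  obtain ⟨v, hv, hev⟩ := (mem_spectrum_cx_iff _ μ).1 hμ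
  rw [cx, fromBlocks_map, fromBlocks_mulVec] at hev
  have h1 : cx A *ᵥ (v ∘ Sum.inl) = μ • (v ∘ Sum.inl) := by
    ext i
    simpa using congrFun hev (Sum.inl i)
  have h2 : cx D *ᵥ (v ∘ Sum.inr) = μ • (v ∘ Sum.inr) := by
    ext i
    simpa using congrFun hev (Sum.inr i)
  by_cases h0 : v ∘ Sum.inl = 0
  · refine hD μ ((mem_spectrum_cx_iff _ μ).2 ⟨_, fun h => hv ?_, h2⟩)
    ext (i | i)
    · exact congrFun h0 i
    · exact congrFun h i
  · exact hA μ ((mem_spectrum_cx_iff _ μ).2 ⟨_, h0, h1⟩)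

section

variable {n m p r : ℕ} {A : Matrix (Fin n) (Fin n) ℝ} {B : Matrix (Fin n) (Fin m) ℝ}
  {C : Matrix (Fin p) (Fin n) ℝ} {V W : Matrix (Fin n) (Fin r) ℝ} {σ : ℕ → ℝ}

/-- Since `σ (r + 1)` is nonnegative, the gap also yields positivity of the retained singular
values. -/
theorem IsBalancingData.gap {P Q R L U Z : Matrix (Fin n) (Fin n) ℝ}
    (h : IsBalancingData A B C σ P Q R L U Z) (hσ : σ r > σ (r + 1)) (i : ℕ) (hi : i < r) :
    σ (r + 1) < σ (i + 1) :=
  hσ.trans_le (h.antitone (i + 1) r (by lia) hi)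

theorem IsBalancedTruncation.isAsymptoticallyStable (h : IsBalancedTruncation A B C r V W σ)
    (hA : IsAsymptoticallyStable A) (hσ : σ r > σ (r + 1)) :
    IsAsymptoticallyStable (redA A V W) := by
  obtain ⟨hr, P, Q, R, L, U, Z, hd, hV, hW⟩ := h.exists_data
  exact hd.isAsymptoticallyStable hA hr
    (fun i hi => (hd.nonneg _).trans_lt (hd.gap hσ i hi)) (hd.gap hσ) hV hW

theorem IsBalancedTruncation.eLpNorm_error_le (h : IsBalancedTruncation A B C r V W σ)
    (hσ : σ r > σ (r + 1)) {u : ℝ → Fin m → ℝ} {x : ℝ → Fin n → ℝ} {xr : ℝ → Fin r → ℝ}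
    (hul : ∀ t, 0 ≤ t → IntervalIntegrable u volume 0 t) {T : ℝ} (hT : 0 ≤ T)
    (hu : MemLp (fun t => WithLp.toLp 2 (u t)) 2 (volume.restrict (Set.Ioc 0 T)))
    (hx : IsTrajectory A B u 0 x) (hxr : IsTrajectory (redA A V W) (Wᵀ * B) u 0 xr) :
    eLpNorm (fun t => WithLp.toLp 2 (C *ᵥ (x t - V *ᵥ xr t))) 2 (volume.restrict (Set.Ioc 0 T)) ≤
      ENNReal.ofReal (2 * ∑ i ∈ Finset.Icc (r + 1) n, σ i) *
        eLpNorm (fun t => WithLp.toLp 2 (u t)) 2 (volume.restrict (Set.Ioc 0 T)) := by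
  obtain ⟨hr, P, Q, R, L, U, Z, hd, hV, hW⟩ := h.exists_data
  exact hd.eLpNorm_error_le hul hT hu hx hr
    (fun i hi => (hd.nonneg _).trans_lt (hd.gap hσ i hi)) hV hW hxr

theorem IsBalancedTruncation.nonneg (h : IsBalancedTruncation A B C r V W σ) (i : ℕ) : 0 ≤ σ i := by
  obtain ⟨-, P, Q, R, L, U, Z, hd, -, -⟩ := h.exists_data
  exact hd.nonneg i

end

end ShiftBT

/-! ### Assembly of the error bound. -/

theorem theorem2 {n m p q k l : ℕ}
    (A : Matrix (Fin n) (Fin n) ℝ) (B : Matrix (Fin n) (Fin m) ℝ)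
    (C : Matrix (Fin p) (Fin n) ℝ) (D : Matrix (Fin p) (Fin m) ℝ)
    (X₀ : Matrix (Fin n) (Fin q) ℝ)
    (hA : ShiftBT.IsAsymptoticallyStable A)
    (α : ℝ) (hα : 0 < α)
    (hk : 1 ≤ k) (hl : 1 ≤ l)
    (V W : Matrix (Fin n) (Fin k) ℝ) (σ : ℕ → ℝ)
    (hBT : ShiftBT.IsBalancedTruncation A B C k V W σ)
    (V' W' : Matrix (Fin n) (Fin l) ℝ) (θ : ℕ → ℝ)
    (hBT' : ShiftBT.IsBalancedTruncation A (ShiftBT.shiftedInput A X₀ α) C l V' W' θ)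
    (hσ : σ k > σ (k + 1)) (hθ : θ l > θ (l + 1))
    (hev : ¬ Module.End.HasEigenvalue (Matrix.toLin' (ShiftBT.redA A V' W')) (-α)) :
    ShiftBT.IsAsymptoticallyStable (ShiftBT.romA A V W V' W') ∧
    ∀ (z₀ : Fin q → ℝ) (u : ℝ → Fin m → ℝ) (x : ℝ → Fin n → ℝ) (xr : ℝ → Fin k ⊕ Fin l → ℝ)
      (y yr : ℝ → Fin p → ℝ),
      ShiftBT.IsTrajectory A B u (X₀ *ᵥ z₀) x →
      ShiftBT.IsTrajectory (ShiftBT.romA A V W V' W') (ShiftBT.romB l B W) u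
        (ShiftBT.romInit k A X₀ α V' W' z₀) xr →
      (∀ t, 0 ≤ t → y t = C *ᵥ x t + D *ᵥ u t) →
      (∀ t, 0 ≤ t → yr t = ShiftBT.romC C V V' *ᵥ xr t + D *ᵥ u t +
        Real.exp (-α * t) • (ShiftBT.redF A C X₀ α V' W' *ᵥ z₀)) →
      yr 0 = y 0 ∧
      (ShiftBT.MemL2 u →
        ShiftBT.MemL2 (fun t => y t - yr t) ∧
        ShiftBT.normL2 (fun t => y t - yr t) ≤
          2 * (∑ i ∈ Finset.Icc (k + 1) n, σ i) * ShiftBT.normL2 u +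
          2 * (∑ i ∈ Finset.Icc (l + 1) n, θ i) * ‖WithLp.toLp 2 z₀‖) := by
  refine ⟨ShiftBT.isAsymptoticallyStable_fromBlocks (hBT.isAsymptoticallyStable hA hσ)
    (hBT'.isAsymptoticallyStable hA hθ), ?_⟩
  intro z₀ u x xr y yr hx hxr hy hyr
  have hdet := ShiftBT.isUnit_det_add_smul_one hev
  set G := ShiftBT.redX₀ A X₀ α V' W' with hG
  -- This is the defining property of the reduced initial value: shifting the reduced free response
  -- produces exactly the projected shifted input.
  have hGeq : (ShiftBT.redA A V' W' + α • (1 : Matrix (Fin l) (Fin l) ℝ)) * G =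
      W'ᵀ * ((A + α • (1 : Matrix (Fin n) (Fin n) ℝ)) * X₀) := by
    rw [hG, ShiftBT.redX₀, Matrix.mul_assoc, Matrix.mul_assoc,
      Matrix.mul_nonsing_inv_cancel_left _ _ hdet]
  have hxk := hxr.map (A' := ShiftBT.redA A V W) (B' := Wᵀ * B)
    (fromCols (1 : Matrix (Fin k) (Fin k) ℝ) (0 : Matrix (Fin k) (Fin l) ℝ))
    (by rw [ShiftBT.romA]; simp [fromCols_mul_fromBlocks, mul_fromCols])
    (by rw [ShiftBT.romB]; simp [fromCols_mul_fromRows])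
  have hxl := hxr.map (A' := ShiftBT.redA A V' W') (B' := (0 : Matrix (Fin l) (Fin m) ℝ))
    (fromCols (0 : Matrix (Fin l) (Fin k) ℝ) (1 : Matrix (Fin l) (Fin l) ℝ))
    (by rw [ShiftBT.romA]; simp [fromCols_mul_fromBlocks, mul_fromCols])
    (by rw [ShiftBT.romB]; simp [fromCols_mul_fromRows])
  have hk0 : fromCols (1 : Matrix (Fin k) (Fin k) ℝ) (0 : Matrix (Fin k) (Fin l) ℝ) *ᵥ
      ShiftBT.romInit k A X₀ α V' W' z₀ = 0 := by
    simp [ShiftBT.romInit, fromCols_mulVec]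
  have hl0 : fromCols (0 : Matrix (Fin l) (Fin k) ℝ) (1 : Matrix (Fin l) (Fin l) ℝ) *ᵥ
      ShiftBT.romInit k A X₀ α V' W' z₀ = G *ᵥ z₀ := by
    simp [ShiftBT.romInit, fromCols_mulVec, hG]
  rw [hk0] at hxk
  rw [hl0] at hxl
  set xk : ℝ → Fin k → ℝ := fun t =>
    fromCols (1 : Matrix (Fin k) (Fin k) ℝ) (0 : Matrix (Fin k) (Fin l) ℝ) *ᵥ xr t with hxk_def
  set xl : ℝ → Fin l → ℝ := fun t =>
    fromCols (0 : Matrix (Fin l) (Fin k) ℝ) (1 : Matrix (Fin l) (Fin l) ℝ) *ᵥ xr t with hxl_def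
  have hC : ∀ t, ShiftBT.romC C V V' *ᵥ xr t = C *ᵥ V *ᵥ xk t + C *ᵥ V' *ᵥ xl t := by
    intro t
    simp [ShiftBT.romC, hxk_def, hxl_def, fromCols_mulVec]
  constructor
  · rw [hy 0 le_rfl, hyr 0 le_rfl, hC, hx.eq_integral 0 le_rfl, hxk.eq_integral 0 le_rfl,
      hxl.eq_integral 0 le_rfl, ShiftBT.redF, ← hG]
    simp only [intervalIntegral.integral_same, add_zero, mulVec_zero, mul_zero, Real.exp_zero,
      one_smul, sub_mulVec, mulVec_mulVec, Matrix.mul_assoc]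
    abel
  intro hu
  obtain ⟨ζ, hζ⟩ := ShiftBT.exists_isTrajectory A B hu.intervalIntegrable
  -- The root cancels the scaling in `shiftedInput` and normalizes the input to `L₂` norm at most
  -- `‖z₀‖`.
  set v : ℝ → Fin q → ℝ := fun t => (Real.sqrt (2 * α) * Real.exp (-α * t)) • z₀ with hv
  have hvc : Continuous v := by fun_prop
  have hsqrt : Real.sqrt (2 * α) ≠ 0 := (Real.sqrt_pos.2 (by linarith)).ne'
  have hBv : ∀ t, ShiftBT.shiftedInput A X₀ α *ᵥ v t =
      Real.exp (-α * t) • ((A + α • (1 : Matrix (Fin n) (Fin n) ℝ)) *ᵥ X₀ *ᵥ z₀) := by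
    intro t
    rw [ShiftBT.shiftedInput, hv, smul_mulVec, mulVec_smul, smul_smul, mulVec_mulVec]
    congr 1
    field_simp
  have hBv' : ∀ t, (W'ᵀ * ShiftBT.shiftedInput A X₀ α) *ᵥ v t = Real.exp (-α * t) •
      ((ShiftBT.redA A V' W' + α • (1 : Matrix (Fin l) (Fin l) ℝ)) *ᵥ G *ᵥ z₀) := by
    intro t
    rw [← mulVec_mulVec, hBv, mulVec_smul]
    congr 1
    simp only [mulVec_mulVec, hGeq]
  have hx1 := hx.sub_sub_exp hζ hBv
  have hl1 := hxl.sub_sub_exp ShiftBT.isTrajectory_zero hBv'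
  -- The `- 0` is the zero-state response of the second block, which receives no `u`; it keeps the
  -- shape delivered by `IsTrajectory.sub_sub_exp`.
  set e : ℝ → Fin p → ℝ := fun t => C *ᵥ (ζ t - V *ᵥ xk t) +
    C *ᵥ (x t - ζ t - Real.exp (-α * t) • X₀ *ᵥ z₀ -
      V' *ᵥ (xl t - 0 - Real.exp (-α * t) • G *ᵥ z₀)) with he
  have hye : ∀ t, 0 ≤ t → y t - yr t = e t := by
    intro t ht
    rw [hy t ht, hyr t ht, hC, ShiftBT.redF, ← hG, he]
    simp only [mulVec_sub, mulVec_smul, sub_mulVec, smul_sub, sub_zero, mulVec_mulVec,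
      Matrix.mul_assoc]
    abel
  have c1 : ContinuousOn (fun t => C *ᵥ (ζ t - V *ᵥ xk t)) (Set.Ici 0) :=
    ShiftBT.continuousOn_mulVec C
      (hζ.continuousOn.sub (ShiftBT.continuousOn_mulVec V hxk.continuousOn))
  have c2 : ContinuousOn (fun t => C *ᵥ (x t - ζ t - Real.exp (-α * t) • X₀ *ᵥ z₀ -
      V' *ᵥ (xl t - 0 - Real.exp (-α * t) • G *ᵥ z₀))) (Set.Ici 0) :=
    ShiftBT.continuousOn_mulVec C
      (hx1.continuousOn.sub (ShiftBT.continuousOn_mulVec V' hl1.continuousOn))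
  have hs0 : 0 ≤ 2 * ∑ i ∈ Finset.Icc (k + 1) n, σ i :=
    mul_nonneg zero_le_two (Finset.sum_nonneg fun i _ => hBT.nonneg i)
  have ht0 : 0 ≤ 2 * ∑ i ∈ Finset.Icc (l + 1) n, θ i :=
    mul_nonneg zero_le_two (Finset.sum_nonneg fun i _ => hBT'.nonneg i)
  have hu0 : 0 ≤ ShiftBT.normL2 u := Real.sqrt_nonneg _
  set K : ℝ := 2 * (∑ i ∈ Finset.Icc (k + 1) n, σ i) * ShiftBT.normL2 u +
    2 * (∑ i ∈ Finset.Icc (l + 1) n, θ i) * ‖WithLp.toLp 2 z₀‖ with hK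
  have hK0 : 0 ≤ K := by positivity
  have hbound : eLpNorm (fun t => WithLp.toLp 2 (e t)) 2 (volume.restrict (Set.Ici 0)) ≤
      ENNReal.ofReal K := by
    refine ShiftBT.eLpNorm_Ici_le_of_forall_Ioc fun T hT => ?_
    have m1 := ShiftBT.memLp_toLp_of_continuousOn (T := T) (c1.mono Set.Icc_subset_Ici_self)
    have m2 := ShiftBT.memLp_toLp_of_continuousOn (T := T) (c2.mono Set.Icc_subset_Ici_self)
    have b1 := hBT.eLpNorm_error_le hσ hu.intervalIntegrable hT (hu.memLp_Ioc T) hζ hxk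
    have b2 := hBT'.eLpNorm_error_le hθ (fun t _ => hvc.intervalIntegrable 0 t) hT
      (ShiftBT.memLp_toLp_of_continuousOn hvc.continuousOn) hx1 hl1
    have b3 : eLpNorm (fun t => WithLp.toLp 2 (u t)) 2 (volume.restrict (Set.Ioc 0 T)) ≤
        ENNReal.ofReal (ShiftBT.normL2 u) := by
      rw [← hu.eLpNorm_eq]
      exact eLpNorm_mono_measure _ (Measure.restrict_mono (fun _ ht => ht.1.le) le_rfl)
    have b4 := ShiftBT.eLpNorm_exp_input_le hα z₀ hT
    rw [hK, ENNReal.ofReal_add (by positivity) (by positivity), ENNReal.ofReal_mul hs0,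
      ENNReal.ofReal_mul ht0]
    refine (eLpNorm_add_le m1.1 m2.1 (by norm_num)).trans (add_le_add ?_ ?_)
    · exact b1.trans (by gcongr)
    · exact b2.trans (by gcongr)
  -- Measurability is read off `e`, which is continuous on `[0, ∞)` because `D u` has cancelled; `y`
  -- and `yr` are prescribed only for `t ≥ 0` and need not be continuous.
  have hemem : ShiftBT.MemL2 e :=
    ⟨((PiLp.continuous_toLp 2 fun _ : Fin p => ℝ).comp_continuousOn
      (c1.add c2)).aestronglyMeasurable measurableSet_Ici, hbound.trans_lt ENNReal.ofReal_lt_top⟩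
  refine ⟨(memLp_congr_ae ?_).1 hemem, ?_⟩
  · filter_upwards [ae_restrict_mem measurableSet_Ici] with t ht
    rw [hye t ht]
  · rw [hemem.eLpNorm_eq, ENNReal.ofReal_le_ofReal_iff hK0] at hbound
    refine le_of_eq_of_le ?_ hbound
    rw [ShiftBT.normL2, ShiftBT.normL2]
    congr 1
    refine setIntegral_congr_fun measurableSet_Ici fun t ht => ?_
    simp only [hye t ht]
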